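/- All logarithms are natural. For a random variable $X$ with values in a finite abelian group $G$, let $H(X)=-\sum_{g\in G}P(X=g)\log P(X=g)$ (with $0\log 0=0$) denote its Shannon entropy. For $x,y\in[0,\log|G|]$ define $$f_G(x,y)=\min\{H(X+Y): X,Y \text{ independent } G\text{-valued random variables},\ H(X)=x,\ H(Y)=y\},$$ and put $f_2=f_{\mathbb{Z}_2}$ on $[0,\log 2]^2$ and $f_4=f_{\mathbb{Z}_4}$ on $[0,\log 4]^2$, where $\mathbb{Z}_n$ is the cyclic group of order $n$. Theorem 3.1. The minima defining $f_2$ and $f_4$ are attained, and $$f_4(x,y)=\begin{cases} x, & \text{if } \log 2\le x\le\log 4,\ 0\le y\le\log 2,\\ y, & \text{if } 0\le x\le\log 2,\ \log 2\le y\le\log 4,\\ f_2(x,y), & \text{if } 0\le x,y\le\log 2,\\ f_2(x-\log 2,\,y-\log 2)+\log 2, & \text{if } \log 2\le x,y\le\log 4.\end{cases}$$ -/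

import Mathlib

open MeasureTheory ProbabilityTheory

universe u v

/-- The Shannon entropy (in nats) `H(X) = -∑ g, P(X = g) log P(X = g)` of a random variable `X`
with values in a finite set `G`, where `0 log 0 = 0`. -/
noncomputable def shannonEntropy {Ω : Type*} [MeasurableSpace Ω] (μ : Measure Ω)
    {G : Type*} [Fintype G] (X : Ω → G) : ℝ :=
  ∑ g : G, Real.negMulLog (μ.real (X ⁻¹' {g}))

/-- The set of all values `H(X + Y)`, where `X` and `Y` run over the pairs of independent `G`-valued
random variables (on a common probability space) with `H(X) = x` and `H(Y) = y`.
The finite group `G` carries the discrete σ-algebra. -/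
def sumEntropies (G : Type v) [AddCommGroup G] [Fintype G] [MeasurableSpace G]
    [DiscreteMeasurableSpace G] (x y : ℝ) : Set ℝ :=
  {s | ∃ (Ω : Type u) (_ : MeasurableSpace Ω) (μ : Measure Ω) (X Y : Ω → G),
    IsProbabilityMeasure μ ∧ Measurable X ∧ Measurable Y ∧ IndepFun X Y μ ∧
    shannonEntropy μ X = x ∧ shannonEntropy μ Y = y ∧
    shannonEntropy μ (fun ω => X ω + Y ω) = s}

/-- `f_G(x, y) = min {H(X + Y) : X, Y independent, H(X) = x, H(Y) = y}`,
written as an infimum. That the infimum is a minimum is expressed by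
`IsLeast (sumEntropies G x y) (minSumEntropy G x y)`. -/
noncomputable def minSumEntropy (G : Type v) [AddCommGroup G] [Fintype G]
    [MeasurableSpace G] [DiscreteMeasurableSpace G] (x y : ℝ) : ℝ :=
  sInf (sumEntropies.{u, v} G x y)

/-!
Write a law on `ZMod 2` through its bias `s` (the probabilities are `(1 ± s) / 2`) and let
`e = biasEntropy` be its entropy, so that `e' = -artanh`. Biases multiply under convolution, hence
`f₂(e(s), e(t)) = e(s t)`.

**Reduction to order two.** On `ZMod 4`, condition on the parities of the summands. The chain rule,
concavity of entropy and Mrs. Gerber's lemma (`f₂` is convex in each variable, `gerber_tangent`)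
give `H(X + Y) ≥ f₂(u, v) + f₂(x - u, y - v)`, where `u` and `v` are the entropies of the parities
(`exists_le_massEntropy_massConv`). It remains to minimize the right-hand side. If
`y ≤ log 2 ≤ x`, the bound `x` follows from `f₂(u, v) ≥ u`. If both `x` and `y` are at most `log 2`,
the claim is that `f₂` is subadditive (`biasEntropy_mul_subadditive`); if both are at least `log 2`,
it is that the deficit `log 2 - f₂`, as a function of the deficits of its arguments, is
superadditive (`deficit_mul_superadditive`). Laws supported on `{0, 2}` or uniform on each of its
cosets attain the bounds.

**Subadditivity.** It is enough to find, for each corner `(x, y)`, a linear form below `f₂` on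
`[0, x] × [0, y]` with equality at `(x, y)` (`exists_linear_le_biasEntropy`). Euler's inequality
`x ∂f₂/∂x + y ∂f₂/∂y ≤ f₂` leaves room for coefficients that are at least the partial derivatives at
the corner. The form is then below `f₂` on the two edges through the corner by convexity, and at
critical points of the difference by Euler's inequality again. The superadditivity of the deficit is
obtained in the same way from the reverse inequality (`exists_deficit_le_linear`).

**Euler's inequalities.** In terms of biases they say that `K(s) + K(t) ≤ K(s t)` for
`K(s) = e(s) / (s artanh s)` and `k(s t) ≤ k(s) + k(t)` for `k(s) = (log 2 - e(s)) / (s artanh s)`.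
The first holds because `K` is a convex function of `-log s` that vanishes as `s → 1`
(`entropyRatio_add_le`). For the second, `1 - k` is a power series in `s²` whose coefficients are
nonnegative, by Kaluza's argument, and have sum at most `1` (`logRatio_add_le`).
-/

open Real Set Filter Topology

/-! ### The entropy of a bit as a function of its bias -/

/-- The entropy `h((1 - s) / 2)` of a bit of bias `s`. -/
noncomputable def biasEntropy (s : ℝ) : ℝ := binEntropy ((1 - s) / 2)

lemma biasEntropy_zero : biasEntropy 0 = log 2 := by
  simp [biasEntropy]

lemma biasEntropy_one : biasEntropy 1 = 0 := by
  simp [biasEntropy]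

lemma biasEntropy_neg (s : ℝ) : biasEntropy (-s) = biasEntropy s := by
  rw [biasEntropy, biasEntropy, ← binEntropy_one_sub]
  congr 1
  ring

lemma biasEntropy_abs (s : ℝ) : biasEntropy |s| = biasEntropy s := by
  rcases abs_choice s with h | h <;> rw [h]
  exact biasEntropy_neg s

lemma biasEntropy_le (s : ℝ) : biasEntropy s ≤ log 2 := binEntropy_le_log_two

@[fun_prop]
lemma continuous_biasEntropy : Continuous biasEntropy := by
  unfold biasEntropy
  fun_prop

lemma biasEntropy_nonneg {s : ℝ} (hs : s ∈ Icc (-1) 1) : 0 ≤ biasEntropy s :=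
  binEntropy_nonneg (by linarith [hs.2]) (by linarith [hs.1])

lemma strictAntiOn_biasEntropy : StrictAntiOn biasEntropy (Icc 0 1) := by
  intro s hs t ht hst
  apply binEntropy_strictMonoOn
  · constructor <;> linarith [ht.1, ht.2]
  · constructor <;> linarith [hs.1, hs.2]
  · linarith

lemma biasEntropy_le_biasEntropy {s t : ℝ} (hs : 0 ≤ s) (hst : s ≤ t) (ht : t ≤ 1) :
    biasEntropy t ≤ biasEntropy s :=
  strictAntiOn_biasEntropy.antitoneOn ⟨hs, hst.trans ht⟩ ⟨hs.trans hst, ht⟩ hst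

lemma exists_biasEntropy_eq {x : ℝ} (hx : x ∈ Icc 0 (log 2)) :
    ∃ s ∈ Icc (0 : ℝ) 1, biasEntropy s = x := by
  have := intermediate_value_Icc' (zero_le_one' ℝ) continuous_biasEntropy.continuousOn
  rw [biasEntropy_zero, biasEntropy_one] at this
  exact this hx

lemma artanh_eq_log_sub_log {s : ℝ} (hs : s ∈ Ioo (-1) 1) :
    artanh s = (log (1 + s) - log (1 - s)) / 2 := by
  rw [artanh_eq_half_log ⟨hs.1.le, hs.2.le⟩, log_div (by linarith [hs.1]) (by linarith [hs.2])]
  ring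

lemma hasDerivAt_artanh {s : ℝ} (hs : s ∈ Ioo (-1) 1) :
    HasDerivAt artanh (1 / (1 - s ^ 2)) s := by
  have h1 : 1 + s ≠ 0 := by linarith [hs.1]
  have h2 : 1 - s ≠ 0 := by linarith [hs.2]
  have h3 : 1 - s ^ 2 ≠ 0 := by
    rw [show 1 - s ^ 2 = (1 + s) * (1 - s) by ring]
    exact mul_ne_zero h1 h2
  have h := ((((hasDerivAt_id s).const_add 1).log h1).sub
    (((hasDerivAt_id s).const_sub 1).log h2)).div_const 2
  refine (h.congr_of_eventuallyEq ?_).congr_deriv ?_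
  · filter_upwards [isOpen_Ioo.mem_nhds hs] with y hy
    simp [artanh_eq_log_sub_log hy]
  · simp only [id]
    field_simp
    ring

lemma hasDerivAt_biasEntropy {s : ℝ} (hs : s ∈ Ioo (-1) 1) :
    HasDerivAt biasEntropy (-artanh s) s := by
  have h1 : (1 - s) / 2 ≠ 0 := by linarith [hs.2]
  have h2 : (1 - s) / 2 ≠ 1 := by linarith [hs.1]
  have h := (hasDerivAt_binEntropy h1 h2).comp s (((hasDerivAt_id s).const_sub 1).div_const 2)
  refine h.congr_deriv ?_
  rw [artanh_eq_log_sub_log hs, show 1 - (1 - s) / 2 = (1 + s) / 2 by ring,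
    log_div (by linarith [hs.1]) two_ne_zero, log_div (by linarith [hs.2]) two_ne_zero]
  ring

lemma biasEntropy_eq {s : ℝ} (hs : s ∈ Ioo (-1) 1) :
    biasEntropy s = log 2 - log (1 - s ^ 2) / 2 - s * artanh s := by
  have h1 : 1 + s ≠ 0 := by linarith [hs.1]
  have h2 : 1 - s ≠ 0 := by linarith [hs.2]
  rw [biasEntropy, binEntropy_eq_negMulLog_add_negMulLog_one_sub, negMulLog, negMulLog,
    artanh_eq_log_sub_log hs, show 1 - (1 - s) / 2 = (1 + s) / 2 by ring, log_div h1 two_ne_zero,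
    log_div h2 two_ne_zero, show 1 - s ^ 2 = (1 + s) * (1 - s) by ring, log_mul h1 h2]
  ring

lemma one_sub_sq_pos {s : ℝ} (hs : s ∈ Ioo (0 : ℝ) 1) : 0 < 1 - s ^ 2 := by
  nlinarith [hs.1, hs.2]

lemma mem_Ioo_neg_one {s : ℝ} (hs : s ∈ Ioo (0 : ℝ) 1) : s ∈ Ioo (-1 : ℝ) 1 :=
  ⟨by linarith [hs.1], hs.2⟩

lemma mul_mem_Ioo {s t : ℝ} (hs : s ∈ Ioo (0 : ℝ) 1) (ht : t ∈ Ioc (0 : ℝ) 1) :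
    s * t ∈ Ioo (0 : ℝ) 1 :=
  ⟨mul_pos hs.1 ht.1, by nlinarith [hs.1, hs.2, ht.1, ht.2]⟩

/-- A function with nonpositive derivative on `(0, 1)` is antitone there. -/
lemma antitoneOn_Ioo_of_hasDerivAt {f f' : ℝ → ℝ}
    (hf : ∀ s ∈ Ioo (0 : ℝ) 1, HasDerivAt f (f' s) s) (hf' : ∀ s ∈ Ioo (0 : ℝ) 1, f' s ≤ 0) :
    AntitoneOn f (Ioo 0 1) := by
  refine antitoneOn_of_hasDerivWithinAt_nonpos (f' := f') (convex_Ioo 0 1)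
    (fun s hs => (hf s hs).continuousAt.continuousWithinAt) (fun s hs => ?_) (fun s hs => ?_)
  · rw [interior_Ioo] at hs
    exact (hf s hs).hasDerivWithinAt
  · rw [interior_Ioo] at hs
    exact hf' s hs

lemma le_artanh {s : ℝ} (hs : s ∈ Ioo (0 : ℝ) 1) : s ≤ artanh s := by
  have hd : ∀ x ∈ Ioo (-1 : ℝ) 1, HasDerivAt (fun x => artanh x - x) (1 / (1 - x ^ 2) - 1) x :=
    fun x hx => (hasDerivAt_artanh hx).sub (hasDerivAt_id x)
  have hm : MonotoneOn (fun x => artanh x - x) (Ico 0 1) := by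
    refine monotoneOn_of_hasDerivWithinAt_nonneg (f' := fun x => 1 / (1 - x ^ 2) - 1)
      (convex_Ico 0 1)
      (fun x hx => (hd x ⟨by linarith [hx.1], hx.2⟩).continuousAt.continuousWithinAt)
      (fun x hx => ?_) (fun x hx => ?_)
    · rw [interior_Ico] at hx
      exact (hd x (mem_Ioo_neg_one hx)).hasDerivWithinAt
    · rw [interior_Ico] at hx
      rw [sub_nonneg, le_div_iff₀ (one_sub_sq_pos hx)]
      nlinarith [hx.1]
  have := hm (left_mem_Ico.2 zero_lt_one) ⟨hs.1.le, hs.2⟩ hs.1.le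
  simp only [artanh_zero] at this
  linarith

/-! ### Mrs. Gerber's lemma -/

lemma antitoneOn_one_sub_sq_mul_artanh_div :
    AntitoneOn (fun s => (1 - s ^ 2) * artanh s / s) (Ioo 0 1) := by
  refine antitoneOn_Ioo_of_hasDerivAt (f' := fun s => (s - (1 + s ^ 2) * artanh s) / s ^ 2)
    (fun s hs => ?_) (fun s hs => ?_)
  · have h := ((((hasDerivAt_pow 2 s).const_sub 1).mul
      (hasDerivAt_artanh (mem_Ioo_neg_one hs))).div (hasDerivAt_id s) hs.1.ne')
    refine h.congr_deriv ?_
    have := (one_sub_sq_pos hs).ne'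
    have := hs.1.ne'
    simp only [id, Pi.mul_apply]
    field_simp
    ring
  · apply div_nonpos_of_nonpos_of_nonneg _ (sq_nonneg s)
    nlinarith [le_artanh hs, sq_nonneg s, hs.1]

/-- The slope `∂f₂/∂x` of Mrs. Gerber's function, in terms of the biases `s` and `t`. -/
noncomputable def gerberSlope (t s : ℝ) : ℝ := t * artanh (s * t) / artanh s

lemma antitoneOn_gerberSlope {t : ℝ} (ht : t ∈ Icc (0 : ℝ) 1) :
    AntitoneOn (gerberSlope t) (Ioo 0 1) := by
  rcases ht.1.eq_or_lt with rfl | h0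
  · intro s _ r _ _
    simp [gerberSlope]
  refine antitoneOn_Ioo_of_hasDerivAt (f' := fun s =>
    (t * (1 / (1 - (s * t) ^ 2) * t) * artanh s - t * artanh (s * t) * (1 / (1 - s ^ 2)))
      / artanh s ^ 2) (fun s hs => ?_) (fun s hs => ?_)
  · have hst := mul_mem_Ioo hs ⟨h0, ht.2⟩
    have h : HasDerivAt (fun r => artanh (r * t)) (1 / (1 - (s * t) ^ 2) * t) s :=
      HasDerivAt.comp s (h₂ := artanh) (h := fun r => r * t)
        (hasDerivAt_artanh (mem_Ioo_neg_one hst)) (hasDerivAt_mul_const t)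
    exact (h.const_mul t).div
      (hasDerivAt_artanh (mem_Ioo_neg_one hs)) (artanh_pos hs).ne'
  · have hst := mul_mem_Ioo hs ⟨h0, ht.2⟩
    apply div_nonpos_of_nonpos_of_nonneg _ (sq_nonneg _)
    have h := antitoneOn_one_sub_sq_mul_artanh_div hst hs (by nlinarith [hs.1, ht.2])
    simp only at h
    rw [div_le_div_iff₀ hs.1 hst.1] at h
    have h1 := one_sub_sq_pos hs
    have h2 := one_sub_sq_pos hst
    rw [sub_nonpos, show t * (1 / (1 - (s * t) ^ 2) * t) * artanh s
      = t * t * artanh s / (1 - (s * t) ^ 2) by ring,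
      show t * artanh (s * t) * (1 / (1 - s ^ 2)) = t * artanh (s * t) / (1 - s ^ 2) by ring,
      div_le_div_iff₀ h2 h1]
    have h3 : s * (t * artanh s * (1 - s ^ 2)) ≤ s * (artanh (s * t) * (1 - (s * t) ^ 2)) := by
      linarith
    have h4 := le_of_mul_le_mul_left h3 hs.1
    nlinarith [mul_le_mul_of_nonneg_left h4 h0.le]

lemma artanh_nonneg_of_mem {s : ℝ} (hs : s ∈ Ico (0 : ℝ) 1) : 0 ≤ artanh s := by
  rcases hs.1.eq_or_lt with rfl | h
  · simp
  · exact (artanh_pos ⟨h, hs.2⟩).le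

lemma gerberSlope_nonneg {s t : ℝ} (hs : s ∈ Ioo (0 : ℝ) 1) (ht : t ∈ Icc (0 : ℝ) 1) :
    0 ≤ gerberSlope t s :=
  div_nonneg (mul_nonneg ht.1 (artanh_nonneg_of_mem
    ⟨mul_nonneg hs.1.le ht.1, by nlinarith [hs.1, hs.2, ht.1, ht.2]⟩)) (artanh_pos hs).le

lemma artanh_mul_le {s t : ℝ} (hs : s ∈ Ioo (0 : ℝ) 1) (ht : t ∈ Icc (0 : ℝ) 1) :
    artanh (s * t) ≤ artanh s := by
  have h : 0 ≤ s * t := mul_nonneg hs.1.le ht.1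
  exact artanh_le_artanh (by linarith) hs.2 (by nlinarith [hs.1, ht.2])

lemma gerberSlope_le_one {s t : ℝ} (hs : s ∈ Ioo (0 : ℝ) 1) (ht : t ∈ Icc (0 : ℝ) 1) :
    gerberSlope t s ≤ 1 := by
  rw [gerberSlope, div_le_one (artanh_pos hs)]
  have h : 0 ≤ s * t := mul_nonneg hs.1.le ht.1
  have h1 := artanh_mul_le hs ht
  have h2 := artanh_nonneg_of_mem (s := s * t) ⟨h, by nlinarith [hs.1, hs.2, ht.1, ht.2]⟩
  nlinarith [ht.2, ht.1]

lemma hasDerivAt_biasEntropy_mul_sub {s t m : ℝ} (hs : s ∈ Ioo (0 : ℝ) 1)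
    (ht : t ∈ Icc (0 : ℝ) 1) :
    HasDerivAt (fun r => biasEntropy (r * t) - m * biasEntropy r)
      (m * artanh s - t * artanh (s * t)) s := by
  have hst : s * t ∈ Ioo (-1 : ℝ) 1 := by
    constructor <;> nlinarith [hs.1, hs.2, ht.1, ht.2, mul_nonneg hs.1.le ht.1]
  have h := ((hasDerivAt_biasEntropy hst).comp s
    (by simpa using (hasDerivAt_id s).mul_const t)).sub
    ((hasDerivAt_biasEntropy (mem_Ioo_neg_one hs)).const_mul m)
  exact h.congr_deriv (by ring)

/-- Mrs. Gerber's lemma: `f₂(·, y)` is convex. It is stated as the inequality between `f₂(·, y)`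
and its tangent at the entropy `h((1 - s) / 2)`, where `y = h((1 - t) / 2)`. -/
lemma gerber_tangent {s t r : ℝ} (hs : s ∈ Ioo (0 : ℝ) 1) (ht : t ∈ Icc (0 : ℝ) 1)
    (hr : r ∈ Icc (0 : ℝ) 1) :
    biasEntropy (s * t) + gerberSlope t s * (biasEntropy r - biasEntropy s)
      ≤ biasEntropy (r * t) := by
  set f : ℝ → ℝ := fun r => biasEntropy (r * t) - gerberSlope t s * biasEntropy r with hf
  have hc : Continuous f := by fun_prop
  -- the derivative of `f` at `x` is `artanh x * (slope at s - slope at x)`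
  have hd : ∀ x ∈ Ioo (0 : ℝ) 1,
      HasDerivAt f (artanh x * (gerberSlope t s - gerberSlope t x)) x := by
    intro x hx
    refine (hasDerivAt_biasEntropy_mul_sub hx ht).congr_deriv ?_
    have := (artanh_pos hx).ne'
    rw [gerberSlope, gerberSlope]
    field_simp
  suffices f s ≤ f r by
    simp only [hf] at this
    linarith
  rcases le_total r s with hrs | hrs
  · have : AntitoneOn f (Icc 0 s) := by
      refine antitoneOn_of_hasDerivWithinAt_nonpos (convex_Icc 0 s) hc.continuousOn
        (f' := fun x => artanh x * (gerberSlope t s - gerberSlope t x))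
        (fun x hx => ?_) (fun x hx => ?_) <;> rw [interior_Icc] at hx
      · exact (hd x ⟨hx.1, hx.2.trans hs.2⟩).hasDerivWithinAt
      · have hx1 : x ∈ Ioo (0 : ℝ) 1 := ⟨hx.1, hx.2.trans hs.2⟩
        exact mul_nonpos_of_nonneg_of_nonpos (artanh_pos hx1).le
          (sub_nonpos.2 (antitoneOn_gerberSlope ht hx1 hs hx.2.le))
    exact this ⟨hr.1, hrs⟩ ⟨hs.1.le, le_rfl⟩ hrs
  · have : MonotoneOn f (Icc s 1) := by
      refine monotoneOn_of_hasDerivWithinAt_nonneg (convex_Icc s 1) hc.continuousOn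
        (f' := fun x => artanh x * (gerberSlope t s - gerberSlope t x))
        (fun x hx => ?_) (fun x hx => ?_) <;> rw [interior_Icc] at hx
      · exact (hd x ⟨hs.1.trans hx.1, hx.2⟩).hasDerivWithinAt
      · have hx1 : x ∈ Ioo (0 : ℝ) 1 := ⟨hs.1.trans hx.1, hx.2⟩
        exact mul_nonneg (artanh_pos hx1).le
          (sub_nonneg.2 (antitoneOn_gerberSlope ht hs hx1 hx.1.le))
    exact this ⟨le_rfl, hs.2.le⟩ ⟨hrs, hr.2⟩ hrs

lemma biasEntropy_le_biasEntropy_mul {s t : ℝ} (hs : s ∈ Icc (0 : ℝ) 1) (ht : t ∈ Icc (0 : ℝ) 1) :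
    biasEntropy s ≤ biasEntropy (s * t) :=
  biasEntropy_le_biasEntropy (mul_nonneg hs.1 ht.1) (mul_le_of_le_one_right hs.1 ht.2) hs.2

/-- `f₂(x, y) ≤ x + y`. -/
lemma biasEntropy_mul_le_add {s t : ℝ} (hs : s ∈ Icc (0 : ℝ) 1) (ht : t ∈ Icc (0 : ℝ) 1) :
    biasEntropy (s * t) ≤ biasEntropy s + biasEntropy t := by
  have : MonotoneOn (fun r => biasEntropy (r * t) - 1 * biasEntropy r) (Icc 0 1) := by
    refine monotoneOn_of_hasDerivWithinAt_nonneg (convex_Icc 0 1)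
      (by fun_prop) (f' := fun x => 1 * artanh x - t * artanh (x * t))
      (fun x hx => ?_) (fun x hx => ?_) <;> rw [interior_Icc] at hx
    · exact (hasDerivAt_biasEntropy_mul_sub hx ht).hasDerivWithinAt
    · have := gerberSlope_le_one hx ht
      rw [gerberSlope, div_le_one (artanh_pos hx)] at this
      linarith
  have := this hs (right_mem_Icc.2 zero_le_one) hs.2
  simp only [one_mul, biasEntropy_one, sub_zero] at this
  linarith

/-! ### Superadditivity of the entropy ratio -/

/-- The ratio `K(s) = e(s) / (s artanh s)`, where `e = biasEntropy`. Euler's inequality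
`x ∂f₂/∂x + y ∂f₂/∂y ≤ f₂` is superadditivity of this function under multiplication of biases. -/
noncomputable def entropyRatio (s : ℝ) : ℝ := biasEntropy s / (s * artanh s)

lemma mul_artanh_pos {s : ℝ} (hs : s ∈ Ioo (0 : ℝ) 1) : 0 < s * artanh s :=
  mul_pos hs.1 (artanh_pos hs)

lemma hasDerivAt_mul_artanh {s : ℝ} (hs : s ∈ Ioo (0 : ℝ) 1) :
    HasDerivAt (fun x => x * artanh x) (artanh s + s / (1 - s ^ 2)) s :=
  ((hasDerivAt_id s).mul (hasDerivAt_artanh (mem_Ioo_neg_one hs))).congr_deriv (by simp; ring)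

lemma biasEntropy_mul_artanh_le {s : ℝ} (hs : s ∈ Ioo (0 : ℝ) 1) :
    biasEntropy s * artanh s ≤
      ((log ((1 - s) / 2) * ((1 - s) / 2) ^ (1 / 2 : ℝ)) ^ 2
        - log ((1 - s) / 2) * ((1 - s) / 2) ^ (1 : ℝ)) / 2 := by
  set p := (1 - s) / 2 with hp
  have hp0 : 0 < p := by linarith [hs.2]
  have hp1 : p < 1 := by linarith [hs.1]
  have hlog : log p ≤ 0 := log_nonpos hp0.le hp1.le
  have hlog' : log (1 - p) ≤ 0 := log_nonpos (by linarith) (by linarith)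
  have hA : artanh s = (log (1 - p) - log p) / 2 := by
    rw [artanh_eq_log_sub_log (mem_Ioo_neg_one hs), hp,
      show 1 - (1 - s) / 2 = (1 + s) / 2 by ring,
      log_div (by linarith [hs.1]) two_ne_zero, log_div (by linarith [hs.2]) two_ne_zero]
    ring
  have hE : biasEntropy s ≤ -(p * log p) + p := by
    rw [biasEntropy, ← hp, binEntropy_eq_negMulLog_add_negMulLog_one_sub, negMulLog, negMulLog]
    have h := one_sub_inv_le_log_of_pos (show 0 < 1 - p by linarith)
    have h2 := mul_le_mul_of_nonneg_left h (show 0 ≤ 1 - p by linarith)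
    have h3 : (1 - p) * (1 - (1 - p)⁻¹) = -p := by
      have : 1 - p ≠ 0 := by linarith
      field_simp
      ring
    linarith
  have hA0 : 0 ≤ artanh s := (artanh_pos hs).le
  have hE0 : 0 ≤ -(p * log p) + p := by nlinarith
  have hpow : (p ^ (1 / 2 : ℝ)) ^ 2 = p := by
    rw [← Real.sqrt_eq_rpow, Real.sq_sqrt hp0.le]
  calc biasEntropy s * artanh s ≤ (-(p * log p) + p) * artanh s :=
        mul_le_mul_of_nonneg_right hE hA0
    _ ≤ (-(p * log p) + p) * (-log p / 2) :=
        mul_le_mul_of_nonneg_left (by rw [hA]; linarith) hE0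
    _ = _ := by
        rw [mul_pow, hpow, rpow_one]
        ring

/-- This quantity governs the monotonicity of `e / ((1 - s²) artanh² s)`, where `e` is the entropy.
It decreases to `0` as `s → 1`, because its derivative is `-e (artanh s + s / (1 - s²))`. -/
lemma sq_artanh_sub_nonneg {s : ℝ} (hs : s ∈ Ioo (0 : ℝ) 1) :
    0 ≤ artanh s ^ 2 * (1 - s ^ 2) / 2 - biasEntropy s * (s * artanh s - 1) := by
  set J : ℝ → ℝ :=
    fun s => artanh s ^ 2 * (1 - s ^ 2) / 2 - biasEntropy s * (s * artanh s - 1) with hJ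
  have hanti : AntitoneOn J (Ioo 0 1) := by
    refine antitoneOn_Ioo_of_hasDerivAt
      (f' := fun s => -(biasEntropy s * (artanh s + s / (1 - s ^ 2))))
      (fun s hs => ?_) (fun s hs => ?_)
    · have hA := hasDerivAt_artanh (mem_Ioo_neg_one hs)
      refine ((((hA.pow 2).mul ((hasDerivAt_pow 2 s).const_sub 1)).div_const 2).sub
        ((hasDerivAt_biasEntropy (mem_Ioo_neg_one hs)).mul
          ((hasDerivAt_mul_artanh hs).sub_const 1))).congr_deriv ?_
      have := (one_sub_sq_pos hs).ne'
      simp only [Pi.pow_apply]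
      field_simp
      ring
    · have h1 := one_sub_sq_pos hs
      have h2 := artanh_pos hs
      have h3 := biasEntropy_nonneg ⟨by linarith [hs.1], hs.2.le⟩
      have h4 := hs.1
      simp only [Left.neg_nonpos_iff]
      positivity
  have hlow : ∀ y ∈ Ioo (0 : ℝ) 1, -(((log ((1 - y) / 2) * ((1 - y) / 2) ^ (1 / 2 : ℝ)) ^ 2
        - log ((1 - y) / 2) * ((1 - y) / 2) ^ (1 : ℝ)) / 2) ≤ J y := by
    intro y hy
    have h1 := biasEntropy_mul_artanh_le hy
    have h2 := one_sub_sq_pos hy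
    have h3 : 0 ≤ biasEntropy y := biasEntropy_nonneg ⟨by linarith [hy.1], hy.2.le⟩
    have h4 : y * artanh y - 1 ≤ artanh y := by nlinarith [hy.2, artanh_pos hy]
    have h5 : 0 ≤ artanh y ^ 2 * (1 - y ^ 2) / 2 := by positivity
    have h6 := mul_le_mul_of_nonneg_left h4 h3
    simp only [hJ]
    linarith
  have hlim : Tendsto (fun y : ℝ => -(((log ((1 - y) / 2) * ((1 - y) / 2) ^ (1 / 2 : ℝ)) ^ 2
        - log ((1 - y) / 2) * ((1 - y) / 2) ^ (1 : ℝ)) / 2)) (𝓝[<] 1) (𝓝 0) := by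
    have hp : Tendsto (fun y : ℝ => (1 - y) / 2) (𝓝[<] 1) (𝓝[>] 0) := by
      refine tendsto_nhdsWithin_iff.2 ⟨?_, ?_⟩
      · have : Continuous fun y : ℝ => (1 - y) / 2 := by fun_prop
        have h := this.tendsto 1
        rw [sub_self, zero_div] at h
        exact h.mono_left nhdsWithin_le_nhds
      · filter_upwards [self_mem_nhdsWithin] with y hy
        have : y < 1 := hy
        show (0 : ℝ) < (1 - y) / 2
        linarith
    have h1 := (tendsto_log_mul_rpow_nhdsGT_zero (show (0 : ℝ) < 1 / 2 by norm_num)).comp hp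
    have h2 := (tendsto_log_mul_rpow_nhdsGT_zero (show (0 : ℝ) < 1 by norm_num)).comp hp
    simpa using (((h1.pow 2).sub h2).div_const 2).neg
  refine le_of_tendsto hlim ?_
  filter_upwards [Ioo_mem_nhdsLT hs.2] with y hy
  have hy1 : y ∈ Ioo (0 : ℝ) 1 := ⟨hs.1.trans hy.1, hy.2⟩
  exact (hlow y hy1).trans (hanti hs hy1 hy.1.le)

/-- The derivative `-s K'(s)` of `K = entropyRatio` with respect to `-log s`. -/
noncomputable def entropyRatioLogDeriv (s : ℝ) : ℝ :=
  entropyRatio s + 1 + biasEntropy s / ((1 - s ^ 2) * artanh s ^ 2)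

lemma hasDerivAt_entropyRatio {s : ℝ} (hs : s ∈ Ioo (0 : ℝ) 1) :
    HasDerivAt entropyRatio (-(entropyRatioLogDeriv s / s)) s := by
  have h := (hasDerivAt_biasEntropy (mem_Ioo_neg_one hs)).div (hasDerivAt_mul_artanh hs)
    (mul_artanh_pos hs).ne'
  refine h.congr_deriv ?_
  have h1 := (one_sub_sq_pos hs).ne'
  have h2 := (artanh_pos hs).ne'
  have h3 := hs.1.ne'
  rw [entropyRatioLogDeriv, entropyRatio]
  field_simp
  ring

lemma entropyRatio_nonneg {s : ℝ} (hs : s ∈ Ioo (0 : ℝ) 1) : 0 ≤ entropyRatio s :=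
  div_nonneg (biasEntropy_nonneg ⟨by linarith [hs.1], hs.2.le⟩) (mul_artanh_pos hs).le

lemma antitoneOn_entropyRatioLogDeriv : AntitoneOn entropyRatioLogDeriv (Ioo 0 1) := by
  have hK : AntitoneOn entropyRatio (Ioo 0 1) := by
    refine antitoneOn_Ioo_of_hasDerivAt (fun s hs => hasDerivAt_entropyRatio hs) (fun s hs => ?_)
    have h1 := one_sub_sq_pos hs
    have h2 := biasEntropy_nonneg (s := s) ⟨by linarith [hs.1], hs.2.le⟩
    have h3 := entropyRatio_nonneg hs
    have h4 := hs.1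
    rw [entropyRatioLogDeriv, Left.neg_nonpos_iff]
    positivity
  have hU : AntitoneOn (fun s => biasEntropy s / ((1 - s ^ 2) * artanh s ^ 2)) (Ioo 0 1) := by
    refine antitoneOn_Ioo_of_hasDerivAt (f' := fun s => -(2 * artanh s *
      (artanh s ^ 2 * (1 - s ^ 2) / 2 - biasEntropy s * (s * artanh s - 1)) /
        ((1 - s ^ 2) * artanh s ^ 2) ^ 2)) (fun s hs => ?_) (fun s hs => ?_)
    · have h1 := (one_sub_sq_pos hs).ne'
      have h2 := (artanh_pos hs).ne'
      have h := (hasDerivAt_biasEntropy (mem_Ioo_neg_one hs)).div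
        (((hasDerivAt_pow 2 s).const_sub 1).mul
          ((hasDerivAt_artanh (mem_Ioo_neg_one hs)).pow 2)) (mul_ne_zero h1 (pow_ne_zero 2 h2))
      refine h.congr_deriv ?_
      simp only [Pi.pow_apply, Pi.mul_apply]
      field_simp
      ring
    · have h1 := sq_artanh_sub_nonneg hs
      have h2 := artanh_pos hs
      rw [Left.neg_nonpos_iff]
      positivity
  intro s hs t ht hst
  have h1 := hK hs ht hst
  have h2 := hU hs ht hst
  simp only at h2
  rw [entropyRatioLogDeriv, entropyRatioLogDeriv]
  linarith

/-- As `-s K'(s)` is decreasing in `s`, `K` is a convex function of `-log s`; it vanishes as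
`s → 1`. -/
lemma entropyRatio_add_le {s t : ℝ} (hs : s ∈ Ioo (0 : ℝ) 1) (ht : t ∈ Ioo (0 : ℝ) 1) :
    entropyRatio s + entropyRatio t ≤ entropyRatio (s * t) := by
  have hanti : AntitoneOn (fun s => entropyRatio (s * t) - entropyRatio s) (Ioo 0 1) := by
    refine antitoneOn_Ioo_of_hasDerivAt
      (f' := fun s => -((entropyRatioLogDeriv (s * t) - entropyRatioLogDeriv s) / s))
      (fun s hs => ?_) (fun s hs => ?_)
    · have hst := mul_mem_Ioo hs ⟨ht.1, ht.2.le⟩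
      have h : HasDerivAt (fun r => entropyRatio (r * t))
          (-(entropyRatioLogDeriv (s * t) / (s * t)) * t) s :=
        HasDerivAt.comp s (h₂ := entropyRatio) (h := fun r => r * t)
          (hasDerivAt_entropyRatio hst) (hasDerivAt_mul_const t)
      refine (h.sub (hasDerivAt_entropyRatio hs)).congr_deriv ?_
      have h1 := hs.1.ne'
      have h2 := ht.1.ne'
      field_simp
      ring
    · have hst := mul_mem_Ioo hs ⟨ht.1, ht.2.le⟩
      have h := antitoneOn_entropyRatioLogDeriv hst hs (by nlinarith [hs.1, ht.2])
      have := hs.1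
      rw [Left.neg_nonpos_iff]
      exact div_nonneg (by linarith) this.le
  have hlim : Tendsto (fun y => entropyRatio (y * t) - 4 * biasEntropy y) (𝓝[<] 1)
      (𝓝 (entropyRatio t)) := by
    have h1 : ContinuousAt (fun y => entropyRatio (y * t)) 1 := by
      refine ContinuousAt.comp (g := entropyRatio) (f := fun y => y * t) ?_ (by fun_prop)
      rw [one_mul]
      exact (hasDerivAt_entropyRatio ht).continuousAt
    have h2 : ContinuousAt (fun y => entropyRatio (y * t) - 4 * biasEntropy y) 1 :=
      h1.sub (by fun_prop)
    have h3 := h2.tendsto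
    simp only [one_mul, biasEntropy_one, mul_zero, sub_zero] at h3
    exact h3.mono_left nhdsWithin_le_nhds
  have hkey : entropyRatio t ≤ entropyRatio (s * t) - entropyRatio s := by
    refine le_of_tendsto hlim ?_
    filter_upwards [Ioo_mem_nhdsLT hs.2, Ioo_mem_nhdsLT (show (1 / 2 : ℝ) < 1 by norm_num)]
      with y hy hy2
    have hy1 : y ∈ Ioo (0 : ℝ) 1 := ⟨hs.1.trans hy.1, hy.2⟩
    have h := hanti hs hy1 hy.1.le
    simp only at h
    have hE := biasEntropy_nonneg (s := y) ⟨by linarith [hy1.1], hy1.2.le⟩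
    have hyA : 1 / 4 ≤ y * artanh y := by nlinarith [le_artanh hy1, hy2.1]
    have : entropyRatio y ≤ 4 * biasEntropy y := by
      rw [entropyRatio, div_le_iff₀ (mul_artanh_pos hy1)]
      nlinarith
    linarith
  linarith

/-! ### Subadditivity of the deficit ratio -/

/-- Kaluza's argument: if `b` is the convolution of `d` and `r` and the ratios of consecutive
terms of `b` dominate those of `d`, then `r` is nonnegative. -/
lemma nonneg_of_convolution {d b r : ℕ → ℝ} (hd : 0 < d 0) (hb : ∀ n, 0 < b n)
    (hconv : ∀ n, ∑ x ∈ Finset.HasAntidiagonal.antidiagonal n, d x.1 * r x.2 = b n)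
    (hratio : ∀ n, ∀ i ≤ n, d (i + 1) * b n ≤ b (n + 1) * d i) (n : ℕ) : 0 ≤ r n := by
  induction n using Nat.strong_induction_on with
  | _ n ih =>
    rcases n with _ | n
    · have h := hconv 0
      simp only [Finset.Nat.antidiagonal_zero, Finset.sum_singleton] at h
      exact (pos_of_mul_pos_right (h ▸ hb 0) hd.le).le
    · have h := hconv (n + 1)
      rw [Finset.Nat.sum_antidiagonal_succ] at h
      have h1 : (∑ x ∈ Finset.HasAntidiagonal.antidiagonal n, d (x.1 + 1) * r x.2) * b n ≤
          b (n + 1) * b n := by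
        rw [Finset.sum_mul]
        conv_rhs => rw [← hconv n, Finset.mul_sum]
        refine Finset.sum_le_sum fun x hx => ?_
        have hx' := Finset.HasAntidiagonal.mem_antidiagonal.1 hx
        have := mul_le_mul_of_nonneg_right (hratio n x.1 (by omega)) (ih x.2 (by omega))
        linarith
      have h2 := le_of_mul_le_mul_right h1 (hb n)
      have h3 : 0 ≤ d 0 * r (n + 1) := by linarith
      exact nonneg_of_mul_nonneg_right h3 hd

lemma hasSum_artanh_div {s : ℝ} (hs : s ∈ Ioo (0 : ℝ) 1) :
    HasSum (fun n : ℕ => 1 / (2 * (n : ℝ) + 1) * (s ^ 2) ^ n) (artanh s / s) := by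
  have h := (hasSum_log_sub_log_of_abs_lt_one (x := s) (abs_lt.2 (mem_Ioo_neg_one hs))).div_const
    (2 * s)
  have h0 := hs.1.ne'
  rw [artanh_eq_log_sub_log (mem_Ioo_neg_one hs), div_div]
  refine Eq.mpr (congrArg (HasSum · _) (funext fun n => ?_)) h
  rw [pow_succ s (2 * n), pow_mul]
  field_simp

lemma hasSum_neg_log_div {s : ℝ} (hs : s ∈ Ioo (0 : ℝ) 1) :
    HasSum (fun n : ℕ => 1 / (2 * (n : ℝ) + 2) * (s ^ 2) ^ n)
      (-log (1 - s ^ 2) / 2 / s ^ 2) := by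
  have h1 := one_sub_sq_pos hs
  have h := (hasSum_pow_div_log_of_abs_lt_one (x := s ^ 2)
    (abs_lt.2 ⟨by nlinarith [sq_nonneg s], by linarith⟩)).div_const (2 * s ^ 2)
  have h0 := hs.1.ne'
  rw [div_div]
  refine Eq.mpr (congrArg (HasSum · _) (funext fun n => ?_)) h
  rw [pow_succ (s ^ 2) n]
  field_simp

/-- The coefficients of the power series of `-log (1 - w) / (2 √w artanh √w)`. -/
noncomputable def logRatioCoeff (n : ℕ) : ℝ :=
  PowerSeries.coeff n ((PowerSeries.mk fun n : ℕ => 1 / (2 * (n : ℝ) + 2)) *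
    (PowerSeries.mk fun n : ℕ => 1 / (2 * (n : ℝ) + 1))⁻¹)

lemma sum_antidiagonal_logRatioCoeff (n : ℕ) :
    ∑ x ∈ Finset.HasAntidiagonal.antidiagonal n, 1 / (2 * (x.1 : ℝ) + 1) * logRatioCoeff x.2
      = 1 / (2 * (n : ℝ) + 2) := by
  set N : PowerSeries ℝ := PowerSeries.mk fun n : ℕ => 1 / (2 * (n : ℝ) + 2) with hN
  set D : PowerSeries ℝ := PowerSeries.mk fun n : ℕ => 1 / (2 * (n : ℝ) + 1) with hD
  have h0 : PowerSeries.constantCoeff D ≠ 0 := by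
    rw [← PowerSeries.coeff_zero_eq_constantCoeff_apply, hD, PowerSeries.coeff_mk]
    norm_num
  have h : D * (N * D⁻¹) = N := by
    rw [mul_left_comm, PowerSeries.mul_inv_cancel D h0, mul_one]
  have h2 := congrArg (PowerSeries.coeff n) h
  rw [PowerSeries.coeff_mul] at h2
  simpa [hN, hD, logRatioCoeff] using h2

lemma logRatioCoeff_nonneg (n : ℕ) : 0 ≤ logRatioCoeff n := by
  refine nonneg_of_convolution (d := fun n : ℕ => 1 / (2 * (n : ℝ) + 1))
    (b := fun n : ℕ => 1 / (2 * (n : ℝ) + 2)) (by norm_num) (fun n => by positivity)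
    sum_antidiagonal_logRatioCoeff (fun n i hi => ?_) n
  have hi' : (i : ℝ) ≤ n := by exact_mod_cast hi
  have hi0 : (0 : ℝ) ≤ i := Nat.cast_nonneg i
  push_cast
  rw [div_mul_div_comm, div_mul_div_comm, div_le_div_iff₀ (by positivity) (by positivity)]
  nlinarith

lemma logRatioCoeff_le (n : ℕ) : logRatioCoeff n ≤ 1 / (2 * (n : ℝ) + 2) := by
  rw [← sum_antidiagonal_logRatioCoeff n]
  have h := Finset.single_le_sum
    (f := fun x : ℕ × ℕ => 1 / (2 * (x.1 : ℝ) + 1) * logRatioCoeff x.2)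
    (fun x _ => mul_nonneg (by positivity) (logRatioCoeff_nonneg x.2))
    (a := ((0, n) : ℕ × ℕ)) (Finset.HasAntidiagonal.mem_antidiagonal.2 (zero_add n))
  simpa using h

lemma summable_logRatioCoeff {w : ℝ} (hw : w ∈ Ico (0 : ℝ) 1) :
    Summable fun n => logRatioCoeff n * w ^ n := by
  refine Summable.of_nonneg_of_le (fun n => mul_nonneg (logRatioCoeff_nonneg n) (pow_nonneg hw.1 n))
    (fun n => ?_) (summable_geometric_of_lt_one hw.1 hw.2)
  have h := logRatioCoeff_le n
  have h2 : 1 / (2 * (n : ℝ) + 2) ≤ 1 := by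
    rw [div_le_one (by positivity)]
    linarith [(Nat.cast_nonneg n : (0 : ℝ) ≤ n)]
  exact mul_le_of_le_one_left (pow_nonneg hw.1 n) (h.trans h2)

/-- The quotient `-log (1 - s²) / (2 s artanh s)`. -/
noncomputable def logRatio (s : ℝ) : ℝ := -log (1 - s ^ 2) / 2 / (s * artanh s)

lemma sq_mem_Ico {s : ℝ} (hs : s ∈ Ioo (0 : ℝ) 1) : s ^ 2 ∈ Ico (0 : ℝ) 1 :=
  ⟨sq_nonneg s, by linarith [one_sub_sq_pos hs]⟩

lemma hasSum_logRatio {s : ℝ} (hs : s ∈ Ioo (0 : ℝ) 1) :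
    HasSum (fun n => logRatioCoeff n * (s ^ 2) ^ n) (logRatio s) := by
  have hR := summable_logRatioCoeff (sq_mem_Ico hs)
  have hD := hasSum_artanh_div hs
  have hN := hasSum_neg_log_div hs
  have h := tsum_mul_tsum_eq_tsum_sum_antidiagonal_of_summable_norm hD.summable.norm hR.norm
  have h2 : ∀ n : ℕ, ∑ x ∈ Finset.HasAntidiagonal.antidiagonal n,
      1 / (2 * (x.1 : ℝ) + 1) * (s ^ 2) ^ x.1 * (logRatioCoeff x.2 * (s ^ 2) ^ x.2)
        = 1 / (2 * (n : ℝ) + 2) * (s ^ 2) ^ n := by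
    intro n
    rw [← sum_antidiagonal_logRatioCoeff n, Finset.sum_mul]
    refine Finset.sum_congr rfl fun x hx => ?_
    rw [← Finset.HasAntidiagonal.mem_antidiagonal.1 hx, pow_add]
    ring
  rw [tsum_congr h2, hN.tsum_eq, hD.tsum_eq] at h
  have h3 : ∑' n, logRatioCoeff n * (s ^ 2) ^ n = logRatio s := by
    have h4 := hs.1.ne'
    have h5 := (artanh_pos hs).ne'
    rw [logRatio]
    field_simp at h ⊢
    linarith
  exact h3 ▸ hR.hasSum

lemma logRatio_le_one {s : ℝ} (hs : s ∈ Ioo (0 : ℝ) 1) : logRatio s ≤ 1 := by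
  have h := hasSum_le (fun n : ℕ => mul_le_mul_of_nonneg_right
    (one_div_le_one_div_of_le (by positivity) (by linarith : 2 * (n : ℝ) + 1 ≤ 2 * (n : ℝ) + 2))
    (pow_nonneg (sq_nonneg s) n)) (hasSum_neg_log_div hs) (hasSum_artanh_div hs)
  have h0 := hs.1
  rw [logRatio, div_le_one (mul_artanh_pos hs)]
  rw [div_le_div_iff₀ (by positivity) h0] at h
  nlinarith

lemma sum_range_logRatioCoeff_le_one (m : ℕ) : ∑ n ∈ Finset.range m, logRatioCoeff n ≤ 1 := by
  have hc : Continuous fun s : ℝ => ∑ n ∈ Finset.range m, logRatioCoeff n * (s ^ 2) ^ n := by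
    fun_prop
  have hlim := (hc.tendsto 1).mono_left (nhdsWithin_le_nhds (s := Iio 1))
  simp only [one_pow, mul_one] at hlim
  refine le_of_tendsto hlim ?_
  filter_upwards [Ioo_mem_nhdsLT (zero_lt_one' ℝ)] with s hs
  refine le_trans ?_ (logRatio_le_one hs)
  exact sum_le_hasSum _ (fun n _ => mul_nonneg (logRatioCoeff_nonneg n)
    (pow_nonneg (sq_nonneg s) n)) (hasSum_logRatio hs)

/-- For each monomial `1 + (st)ⁿ - sⁿ - tⁿ = (1 - sⁿ) (1 - tⁿ) ≥ 0`, and the power series of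
`logRatio` has nonnegative coefficients with sum at most `1`. -/
lemma logRatio_add_le {s t : ℝ} (hs : s ∈ Ioo (0 : ℝ) 1) (ht : t ∈ Ioo (0 : ℝ) 1) :
    logRatio s + logRatio t ≤ 1 + logRatio (s * t) := by
  have hst := mul_mem_Ioo hs ⟨ht.1, ht.2.le⟩
  have h := ((hasSum_logRatio hs).add (hasSum_logRatio ht)).sub (hasSum_logRatio hst)
  suffices logRatio s + logRatio t - logRatio (s * t) ≤ 1 by linarith
  refine le_of_tendsto' h.tendsto_sum_nat fun m => ?_
  refine le_trans (Finset.sum_le_sum fun n _ => ?_) (sum_range_logRatioCoeff_le_one m)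
  have h1 : (s ^ 2) ^ n ≤ 1 := pow_le_one₀ (sq_mem_Ico hs).1 (sq_mem_Ico hs).2.le
  have h2 : (t ^ 2) ^ n ≤ 1 := pow_le_one₀ (sq_mem_Ico ht).1 (sq_mem_Ico ht).2.le
  have h3 := mul_nonneg (logRatioCoeff_nonneg n)
    (mul_nonneg (sub_nonneg.2 h1) (sub_nonneg.2 h2))
  rw [mul_pow s t 2, mul_pow]
  nlinarith

/-- The counterpart of `entropyRatio` for the entropy deficit `log 2 - h`. -/
noncomputable def deficitRatio (s : ℝ) : ℝ := (log 2 - biasEntropy s) / (s * artanh s)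

lemma deficitRatio_eq {s : ℝ} (hs : s ∈ Ioo (0 : ℝ) 1) : deficitRatio s = 1 - logRatio s := by
  have h1 := hs.1.ne'
  have h2 := (artanh_pos hs).ne'
  rw [deficitRatio, logRatio, biasEntropy_eq (mem_Ioo_neg_one hs)]
  field_simp
  ring

lemma deficitRatio_mul_le {s t : ℝ} (hs : s ∈ Ioo (0 : ℝ) 1) (ht : t ∈ Ioo (0 : ℝ) 1) :
    deficitRatio (s * t) ≤ deficitRatio s + deficitRatio t := by
  rw [deficitRatio_eq hs, deficitRatio_eq ht, deficitRatio_eq (mul_mem_Ioo hs ⟨ht.1, ht.2.le⟩)]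
  linarith [logRatio_add_le hs ht]

/-! ### Subadditivity of Mrs. Gerber's function and superadditivity of its deficit -/

lemma biasEntropy_le_biasEntropy_iff {s t : ℝ} (hs : s ∈ Icc (0 : ℝ) 1) (ht : t ∈ Icc (0 : ℝ) 1) :
    biasEntropy s ≤ biasEntropy t ↔ t ≤ s :=
  strictAntiOn_biasEntropy.le_iff_ge hs ht

/-- Euler's inequality `x ∂f₂/∂x + y ∂f₂/∂y ≤ f₂`. -/
lemma euler_biasEntropy {s t : ℝ} (hs : s ∈ Ioo (0 : ℝ) 1) (ht : t ∈ Ioo (0 : ℝ) 1) :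
    gerberSlope t s * biasEntropy s + gerberSlope s t * biasEntropy t ≤ biasEntropy (s * t) := by
  have hst := mul_mem_Ioo hs ⟨ht.1, ht.2.le⟩
  have h := mul_le_mul_of_nonneg_right (entropyRatio_add_le hs ht) (mul_artanh_pos hst).le
  have h1 := (artanh_pos hs).ne'
  have h2 := (artanh_pos ht).ne'
  have h3 := (artanh_pos hst).ne'
  have h4 := hs.1.ne'
  have h5 := ht.1.ne'
  calc gerberSlope t s * biasEntropy s + gerberSlope s t * biasEntropy t
      = (entropyRatio s + entropyRatio t) * (s * t * artanh (s * t)) := by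
        rw [gerberSlope, gerberSlope, entropyRatio, entropyRatio, mul_comm t s]
        field_simp
    _ ≤ entropyRatio (s * t) * (s * t * artanh (s * t)) := h
    _ = biasEntropy (s * t) := by
        rw [entropyRatio]
        field_simp

/-- Euler's inequality for the deficit `log 2 - f₂`, as a function of the deficits of `x`
and `y`. -/
lemma euler_deficit {s t : ℝ} (hs : s ∈ Ioo (0 : ℝ) 1) (ht : t ∈ Ioo (0 : ℝ) 1) :
    log 2 - biasEntropy (s * t) ≤ gerberSlope t s * (log 2 - biasEntropy s) +
      gerberSlope s t * (log 2 - biasEntropy t) := by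
  have hst := mul_mem_Ioo hs ⟨ht.1, ht.2.le⟩
  have h := mul_le_mul_of_nonneg_right (deficitRatio_mul_le hs ht) (mul_artanh_pos hst).le
  have h1 := (artanh_pos hs).ne'
  have h2 := (artanh_pos ht).ne'
  have h3 := (artanh_pos hst).ne'
  have h4 := hs.1.ne'
  have h5 := ht.1.ne'
  calc log 2 - biasEntropy (s * t) = deficitRatio (s * t) * (s * t * artanh (s * t)) := by
        rw [deficitRatio]
        field_simp
    _ ≤ (deficitRatio s + deficitRatio t) * (s * t * artanh (s * t)) := h
    _ = _ := by
        rw [gerberSlope, gerberSlope, deficitRatio, deficitRatio, mul_comm t s]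
        field_simp

lemma eq_gerberSlope_of_isLocalMin {σ τ a c : ℝ} (hσ : σ ∈ Ioo (0 : ℝ) 1)
    (hτ : τ ∈ Icc (0 : ℝ) 1)
    (h : IsLocalMin (fun r => biasEntropy (r * τ) - a * biasEntropy r - c) σ) :
    a = gerberSlope τ σ := by
  have h0 := h.hasDerivAt_eq_zero ((hasDerivAt_biasEntropy_mul_sub hσ hτ).sub_const c)
  rw [gerberSlope, eq_div_iff (artanh_pos hσ).ne']
  linarith

/-- To bound `f₂(x, y) - a x - b y` from below on a box, it suffices to look at the boundary of the
box and at the critical points, where `a = ∂f₂/∂x` and `b = ∂f₂/∂y`. -/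
lemma le_on_box {a b c s₀ s₁ t₀ t₁ : ℝ} (hs₀ : 0 ≤ s₀) (hs₁ : s₁ ≤ 1) (ht₀ : 0 ≤ t₀) (ht₁ : t₁ ≤ 1)
    (hleft : ∀ t ∈ Icc t₀ t₁, c ≤ biasEntropy (s₀ * t) - a * biasEntropy s₀ - b * biasEntropy t)
    (hright : ∀ t ∈ Icc t₀ t₁, c ≤ biasEntropy (s₁ * t) - a * biasEntropy s₁ - b * biasEntropy t)
    (hbot : ∀ s ∈ Icc s₀ s₁, c ≤ biasEntropy (s * t₀) - a * biasEntropy s - b * biasEntropy t₀)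
    (htop : ∀ s ∈ Icc s₀ s₁, c ≤ biasEntropy (s * t₁) - a * biasEntropy s - b * biasEntropy t₁)
    (hcrit : ∀ s ∈ Ioo (0 : ℝ) 1, ∀ t ∈ Ioo (0 : ℝ) 1, a = gerberSlope t s → b = gerberSlope s t →
      c ≤ biasEntropy (s * t) - a * biasEntropy s - b * biasEntropy t)
    {s t : ℝ} (hs : s ∈ Icc s₀ s₁) (ht : t ∈ Icc t₀ t₁) :
    c ≤ biasEntropy (s * t) - a * biasEntropy s - b * biasEntropy t := by
  set f : ℝ × ℝ → ℝ :=
    fun z => biasEntropy (z.1 * z.2) - a * biasEntropy z.1 - b * biasEntropy z.2 with hf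
  have hc : Continuous f := by fun_prop
  obtain ⟨⟨σ, τ⟩, ⟨hσ, hτ⟩, hmin⟩ := (isCompact_Icc.prod isCompact_Icc).exists_isMinOn
    (s := Icc s₀ s₁ ×ˢ Icc t₀ t₁) ⟨(s, t), hs, ht⟩ hc.continuousOn
  simp only at hσ hτ
  have hmin' : ∀ s ∈ Icc s₀ s₁, ∀ t ∈ Icc t₀ t₁, f (σ, τ) ≤ f (s, t) :=
    fun s hs t ht => hmin (a := (s, t)) ⟨hs, ht⟩
  refine le_trans ?_ (hmin' s hs t ht)
  rcases hσ.1.eq_or_lt with rfl | h1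
  · exact hleft τ hτ
  rcases hσ.2.eq_or_lt with rfl | h2
  · exact hright τ hτ
  rcases hτ.1.eq_or_lt with rfl | h3
  · exact hbot σ hσ
  rcases hτ.2.eq_or_lt with rfl | h4
  · exact htop σ hσ
  have hσ' : σ ∈ Ioo (0 : ℝ) 1 := ⟨by linarith, by linarith⟩
  have hτ' : τ ∈ Ioo (0 : ℝ) 1 := ⟨by linarith, by linarith⟩
  refine hcrit σ hσ' τ hτ' ?_ ?_
  · refine eq_gerberSlope_of_isLocalMin (c := b * biasEntropy τ) hσ' ⟨hτ'.1.le, hτ'.2.le⟩ ?_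
    filter_upwards [isOpen_Ioo.mem_nhds ⟨h1, h2⟩] with r hr
    exact hmin' r ⟨hr.1.le, hr.2.le⟩ τ hτ
  · refine eq_gerberSlope_of_isLocalMin (c := a * biasEntropy σ) hτ' ⟨hσ'.1.le, hσ'.2.le⟩ ?_
    filter_upwards [isOpen_Ioo.mem_nhds ⟨h3, h4⟩] with r hr
    have h := hmin' σ hσ r ⟨hr.1.le, hr.2.le⟩
    simp only [hf] at h
    rw [mul_comm τ σ, mul_comm r σ]
    linarith

/-- On the box `[0, x] × [0, y]`, the function `f₂` lies above a linear form with equality at the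
corner `(x, y)`. -/
lemma exists_linear_le_biasEntropy {s t : ℝ} (hs : s ∈ Ioo (0 : ℝ) 1) (ht : t ∈ Ioo (0 : ℝ) 1) :
    ∃ a b : ℝ, a * biasEntropy s + b * biasEntropy t = biasEntropy (s * t) ∧
      ∀ s' ∈ Icc s 1, ∀ t' ∈ Icc t 1,
        a * biasEntropy s' + b * biasEntropy t' ≤ biasEntropy (s' * t') := by
  have hs' : s ∈ Icc (0 : ℝ) 1 := ⟨hs.1.le, hs.2.le⟩
  have ht' : t ∈ Icc (0 : ℝ) 1 := ⟨ht.1.le, ht.2.le⟩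
  -- Slopes between the partial derivatives and `1`; they exist as
  -- `x ∂f₂/∂x + y ∂f₂/∂y ≤ f₂ ≤ x + y`.
  obtain ⟨a, b, ha, ha1, hb, hb1, hab⟩ : ∃ a b : ℝ, gerberSlope t s ≤ a ∧ a ≤ 1 ∧
      gerberSlope s t ≤ b ∧ b ≤ 1 ∧
      a * biasEntropy s + b * biasEntropy t = biasEntropy (s * t) := by
    have hc : ContinuousOn (fun θ : ℝ =>
        (gerberSlope t s + θ * (1 - gerberSlope t s)) * biasEntropy s +
        (gerberSlope s t + θ * (1 - gerberSlope s t)) * biasEntropy t) (Icc 0 1) := by fun_prop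
    have himg := intermediate_value_Icc (zero_le_one' ℝ) hc
    have h1 := euler_biasEntropy hs ht
    have h2 := biasEntropy_mul_le_add hs' ht'
    have h3 : gerberSlope t s ≤ 1 := gerberSlope_le_one hs ht'
    have h4 : gerberSlope s t ≤ 1 := gerberSlope_le_one ht hs'
    obtain ⟨θ, hθ, h⟩ := himg ⟨by linarith, by linarith⟩
    refine ⟨_, _, ?_, ?_, ?_, ?_, h⟩
    · nlinarith [hθ.1]
    · nlinarith [hθ.2]
    · nlinarith [hθ.1]
    · nlinarith [hθ.2]
  refine ⟨a, b, hab, fun s' hs1 t' ht1 => ?_⟩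
  suffices 0 ≤ biasEntropy (s' * t') - a * biasEntropy s' - b * biasEntropy t' by linarith
  refine le_on_box hs.1.le le_rfl ht.1.le le_rfl (fun r hr => ?_) (fun r hr => ?_) (fun r hr => ?_)
    (fun r hr => ?_) (fun σ hσ τ hτ h1 h2 => ?_) hs1 ht1
  · have hr' : r ∈ Icc (0 : ℝ) 1 := ⟨ht.1.le.trans hr.1, hr.2⟩
    have h := gerber_tangent ht hs' hr'
    have h2 := biasEntropy_le_biasEntropy ht.1.le hr.1 hr.2
    rw [mul_comm t s, mul_comm r s] at h
    nlinarith
  · have h := biasEntropy_nonneg (s := r) ⟨by linarith [hr.1, ht.1], hr.2⟩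
    rw [biasEntropy_one, one_mul]
    nlinarith
  · have hr' : r ∈ Icc (0 : ℝ) 1 := ⟨hs.1.le.trans hr.1, hr.2⟩
    have h := gerber_tangent hs ht' hr'
    have h2 := biasEntropy_le_biasEntropy hs.1.le hr.1 hr.2
    nlinarith
  · have h := biasEntropy_nonneg (s := r) ⟨by linarith [hr.1, hs.1], hr.2⟩
    rw [biasEntropy_one, mul_one]
    nlinarith
  · subst h1 h2
    linarith [euler_biasEntropy hσ hτ]

/-- The counterpart of `exists_linear_le_biasEntropy` for the deficit `log 2 - f₂`, which lies below
a linear form in the deficits of `x` and `y`. -/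
lemma exists_deficit_le_linear {s t : ℝ} (hs : s ∈ Ioo (0 : ℝ) 1) (ht : t ∈ Ioo (0 : ℝ) 1) :
    ∃ a b : ℝ, a * (log 2 - biasEntropy s) + b * (log 2 - biasEntropy t)
        = log 2 - biasEntropy (s * t) ∧
      ∀ s' ∈ Icc 0 s, ∀ t' ∈ Icc 0 t, log 2 - biasEntropy (s' * t') ≤
        a * (log 2 - biasEntropy s') + b * (log 2 - biasEntropy t') := by
  have hs' : s ∈ Icc (0 : ℝ) 1 := ⟨hs.1.le, hs.2.le⟩
  have ht' : t ∈ Icc (0 : ℝ) 1 := ⟨ht.1.le, ht.2.le⟩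
  obtain ⟨a, b, ha, ha1, hb, hb1, hab⟩ : ∃ a b : ℝ, 0 ≤ a ∧ a ≤ gerberSlope t s ∧
      0 ≤ b ∧ b ≤ gerberSlope s t ∧
      a * (log 2 - biasEntropy s) + b * (log 2 - biasEntropy t)
        = log 2 - biasEntropy (s * t) := by
    have hc : ContinuousOn (fun θ : ℝ =>
        (θ * gerberSlope t s) * (log 2 - biasEntropy s) +
        (θ * gerberSlope s t) * (log 2 - biasEntropy t)) (Icc 0 1) := by fun_prop
    have himg := intermediate_value_Icc (zero_le_one' ℝ) hc
    have h1 := euler_deficit hs ht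
    have h2 := biasEntropy_le (s * t)
    have h3 : 0 ≤ gerberSlope t s := gerberSlope_nonneg hs ht'
    have h4 : 0 ≤ gerberSlope s t := gerberSlope_nonneg ht hs'
    obtain ⟨θ, hθ, h⟩ := himg (show log 2 - biasEntropy (s * t) ∈ Icc _ _ from
      ⟨by linarith, by linarith⟩)
    exact ⟨_, _, mul_nonneg hθ.1 h3, mul_le_of_le_one_left h3 hθ.2, mul_nonneg hθ.1 h4,
      mul_le_of_le_one_left h4 hθ.2, h⟩
  refine ⟨a, b, hab, fun s' hs1 t' ht1 => ?_⟩
  suffices log 2 - a * log 2 - b * log 2 ≤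
      biasEntropy (s' * t') - a * biasEntropy s' - b * biasEntropy t' by linarith
  refine le_on_box le_rfl hs.2.le le_rfl ht.2.le (fun r hr => ?_) (fun r hr => ?_) (fun r hr => ?_)
    (fun r hr => ?_) (fun σ hσ τ hτ h1 h2 => ?_) hs1 ht1
  · rw [zero_mul, biasEntropy_zero]
    nlinarith [biasEntropy_le r]
  · have h := gerber_tangent ht hs' ⟨hr.1, hr.2.trans ht.2.le⟩
    have h2 := biasEntropy_le_biasEntropy hr.1 hr.2 ht.2.le
    rw [mul_comm t s, mul_comm r s] at h
    nlinarith
  · rw [mul_zero, biasEntropy_zero]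
    nlinarith [biasEntropy_le r]
  · have h := gerber_tangent hs ht' ⟨hr.1, hr.2.trans hs.2.le⟩
    have h2 := biasEntropy_le_biasEntropy hr.1 hr.2 hs.2.le
    nlinarith
  · subst h1 h2
    linarith [euler_deficit hσ hτ]

lemma biasEntropy_nonneg' {s : ℝ} (hs : s ∈ Icc (0 : ℝ) 1) : 0 ≤ biasEntropy s :=
  biasEntropy_nonneg ⟨by linarith [hs.1], hs.2⟩

lemma biasEntropy_le_biasEntropy_mul' {s t : ℝ} (hs : s ∈ Icc (0 : ℝ) 1)
    (ht : t ∈ Icc (0 : ℝ) 1) : biasEntropy t ≤ biasEntropy (s * t) := by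
  rw [mul_comm]
  exact biasEntropy_le_biasEntropy_mul ht hs

/-- Mrs. Gerber's function `f₂` is subadditive on its square. -/
lemma biasEntropy_mul_subadditive {s s₁ s₂ t t₁ t₂ : ℝ} (hs : s ∈ Icc (0 : ℝ) 1)
    (hs₁ : s₁ ∈ Icc (0 : ℝ) 1) (hs₂ : s₂ ∈ Icc (0 : ℝ) 1) (ht : t ∈ Icc (0 : ℝ) 1)
    (ht₁ : t₁ ∈ Icc (0 : ℝ) 1) (ht₂ : t₂ ∈ Icc (0 : ℝ) 1)
    (hss : biasEntropy s₁ + biasEntropy s₂ = biasEntropy s)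
    (htt : biasEntropy t₁ + biasEntropy t₂ = biasEntropy t) :
    biasEntropy (s * t) ≤ biasEntropy (s₁ * t₁) + biasEntropy (s₂ * t₂) := by
  have p1 := biasEntropy_nonneg' hs₁
  have p2 := biasEntropy_nonneg' hs₂
  have q1 := biasEntropy_nonneg' ht₁
  have q2 := biasEntropy_nonneg' ht₂
  have m1 := biasEntropy_le_biasEntropy_mul hs₁ ht₁
  have m2 := biasEntropy_le_biasEntropy_mul hs₂ ht₂
  have n1 := biasEntropy_le_biasEntropy_mul' hs₁ ht₁
  have n2 := biasEntropy_le_biasEntropy_mul' hs₂ ht₂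
  rcases hs.1.eq_or_lt with rfl | hs0
  · rw [zero_mul]
    linarith
  rcases ht.1.eq_or_lt with rfl | ht0
  · rw [mul_zero]
    linarith
  rcases hs.2.eq_or_lt with rfl | hs1
  · rw [one_mul]
    linarith
  rcases ht.2.eq_or_lt with rfl | ht1
  · rw [mul_one]
    linarith
  obtain ⟨a, b, hab, h⟩ := exists_linear_le_biasEntropy ⟨hs0, hs1⟩ ⟨ht0, ht1⟩
  have h1 := h s₁ ⟨(biasEntropy_le_biasEntropy_iff hs₁ hs).1 (by linarith), hs₁.2⟩
    t₁ ⟨(biasEntropy_le_biasEntropy_iff ht₁ ht).1 (by linarith), ht₁.2⟩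
  have h2 := h s₂ ⟨(biasEntropy_le_biasEntropy_iff hs₂ hs).1 (by linarith), hs₂.2⟩
    t₂ ⟨(biasEntropy_le_biasEntropy_iff ht₂ ht).1 (by linarith), ht₂.2⟩
  rw [← hab, ← hss, ← htt]
  linarith

/-- The deficit `log 2 - f₂` is superadditive in the deficits of `x` and `y`. -/
lemma deficit_mul_superadditive {s s₁ s₂ t t₁ t₂ : ℝ} (hs : s ∈ Icc (0 : ℝ) 1)
    (hs₁ : s₁ ∈ Icc (0 : ℝ) 1) (hs₂ : s₂ ∈ Icc (0 : ℝ) 1) (ht : t ∈ Icc (0 : ℝ) 1)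
    (ht₁ : t₁ ∈ Icc (0 : ℝ) 1) (ht₂ : t₂ ∈ Icc (0 : ℝ) 1)
    (hss : biasEntropy s₁ + biasEntropy s₂ = log 2 + biasEntropy s)
    (htt : biasEntropy t₁ + biasEntropy t₂ = log 2 + biasEntropy t) :
    log 2 + biasEntropy (s * t) ≤ biasEntropy (s₁ * t₁) + biasEntropy (s₂ * t₂) := by
  have p1 := biasEntropy_le s₁
  have p2 := biasEntropy_le s₂
  have q1 := biasEntropy_le t₁
  have q2 := biasEntropy_le t₂
  have m1 := biasEntropy_le_biasEntropy_mul hs₁ ht₁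
  have m2 := biasEntropy_le_biasEntropy_mul hs₂ ht₂
  have n1 := biasEntropy_le_biasEntropy_mul' hs₁ ht₁
  have n2 := biasEntropy_le_biasEntropy_mul' hs₂ ht₂
  rcases hs.1.eq_or_lt with rfl | hs0
  · rw [zero_mul]
    linarith
  rcases ht.1.eq_or_lt with rfl | ht0
  · rw [mul_zero]
    linarith
  rcases hs.2.eq_or_lt with rfl | hs1
  · rw [one_mul]
    linarith
  rcases ht.2.eq_or_lt with rfl | ht1
  · rw [mul_one]
    linarith
  obtain ⟨a, b, hab, h⟩ := exists_deficit_le_linear ⟨hs0, hs1⟩ ⟨ht0, ht1⟩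
  have h1 := h s₁ ⟨hs₁.1, (biasEntropy_le_biasEntropy_iff hs hs₁).1 (by linarith)⟩
    t₁ ⟨ht₁.1, (biasEntropy_le_biasEntropy_iff ht ht₁).1 (by linarith)⟩
  have h2 := h s₂ ⟨hs₂.1, (biasEntropy_le_biasEntropy_iff hs hs₂).1 (by linarith)⟩
    t₂ ⟨ht₂.1, (biasEntropy_le_biasEntropy_iff ht ht₂).1 (by linarith)⟩
  have e1 : biasEntropy s = biasEntropy s₁ + biasEntropy s₂ - log 2 := by linarith
  have e2 : biasEntropy t = biasEntropy t₁ + biasEntropy t₂ - log 2 := by linarith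
  rw [e1, e2] at hab
  linarith

/-- Jensen's inequality for the convex function `f₂(·, y)`. -/
lemma gerber_jensen {w₀ w₁ s s₀ s₁ t : ℝ} (hw₀ : 0 ≤ w₀) (hw₁ : 0 ≤ w₁) (hw : w₀ + w₁ = 1)
    (hs : s ∈ Icc (0 : ℝ) 1) (hs₀ : s₀ ∈ Icc (0 : ℝ) 1) (hs₁ : s₁ ∈ Icc (0 : ℝ) 1)
    (ht : t ∈ Icc (0 : ℝ) 1) (h : w₀ * biasEntropy s₀ + w₁ * biasEntropy s₁ = biasEntropy s) :
    biasEntropy (s * t) ≤ w₀ * biasEntropy (s₀ * t) + w₁ * biasEntropy (s₁ * t) := by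
  rcases hs.1.eq_or_lt with rfl | hs0
  · rw [zero_mul, ← h]
    exact add_le_add (mul_le_mul_of_nonneg_left (biasEntropy_le_biasEntropy_mul hs₀ ht) hw₀)
      (mul_le_mul_of_nonneg_left (biasEntropy_le_biasEntropy_mul hs₁ ht) hw₁)
  rcases hs.2.eq_or_lt with rfl | hs1
  · have h0 := mul_le_mul_of_nonneg_left (biasEntropy_le_biasEntropy_mul' hs₀ ht) hw₀
    have h1 := mul_le_mul_of_nonneg_left (biasEntropy_le_biasEntropy_mul' hs₁ ht) hw₁
    rw [one_mul]
    calc biasEntropy t = w₀ * biasEntropy t + w₁ * biasEntropy t := by rw [← add_mul, hw, one_mul]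
      _ ≤ _ := add_le_add h0 h1
  have h0 := mul_le_mul_of_nonneg_left (gerber_tangent ⟨hs0, hs1⟩ ht hs₀) hw₀
  have h1 := mul_le_mul_of_nonneg_left (gerber_tangent ⟨hs0, hs1⟩ ht hs₁) hw₁
  have h2 : w₀ * (biasEntropy (s * t) + gerberSlope t s * (biasEntropy s₀ - biasEntropy s)) +
      w₁ * (biasEntropy (s * t) + gerberSlope t s * (biasEntropy s₁ - biasEntropy s))
      = biasEntropy (s * t) := by
    obtain rfl : w₁ = 1 - w₀ := by linarith
    linear_combination gerberSlope t s * h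
  linarith

/-! ### Laws of independent sums -/

/-- The Shannon entropy of a probability vector. -/
noncomputable def massEntropy {G : Type*} [Fintype G] (p : G → ℝ) : ℝ := ∑ g, negMulLog (p g)

/-- The convolution of two functions on a finite abelian group: the law of the sum of two
independent random variables with laws `p` and `q`. -/
noncomputable def massConv {G : Type*} [AddCommGroup G] [Fintype G] (p q : G → ℝ) (g : G) : ℝ :=
  ∑ h, p h * q (g - h)

section RandomVariables

variable {Ω G : Type*} [MeasurableSpace Ω] {μ : Measure Ω} [IsProbabilityMeasure μ]
  [Fintype G] [MeasurableSpace G] [DiscreteMeasurableSpace G]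

lemma sum_measureReal_inter_preimage {X : Ω → G} (hX : Measurable X) (A : Set Ω) :
    ∑ g, μ.real (X ⁻¹' {g} ∩ A) = μ.real A := by
  have h := sum_measure_preimage_singleton (μ := μ.restrict A) Finset.univ (f := X)
    (fun y _ => hX (measurableSet_singleton y))
  simp only [Finset.coe_univ, preimage_univ, Measure.restrict_apply_univ] at h
  rw [measureReal_def, ← h, ENNReal.toReal_sum (fun g _ => measure_ne_top _ _)]
  refine Finset.sum_congr rfl fun g _ => ?_
  rw [measureReal_def, Measure.restrict_apply (hX (measurableSet_singleton g))]

lemma law_mem_stdSimplex {X : Ω → G} (hX : Measurable X) :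
    (fun g => μ.real (X ⁻¹' {g})) ∈ stdSimplex ℝ G := by
  refine ⟨fun g => measureReal_nonneg, ?_⟩
  have h := sum_measureReal_inter_preimage (μ := μ) hX univ
  simpa using h

lemma law_add [AddCommGroup G] {X Y : Ω → G} (hX : Measurable X)
    (hXY : IndepFun X Y μ) (g : G) :
    μ.real ((fun ω => X ω + Y ω) ⁻¹' {g}) =
      massConv (fun g => μ.real (X ⁻¹' {g})) (fun g => μ.real (Y ⁻¹' {g})) g := by
  rw [← sum_measureReal_inter_preimage hX, massConv]
  refine Finset.sum_congr rfl fun h _ => ?_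
  have h1 : X ⁻¹' {h} ∩ (fun ω => X ω + Y ω) ⁻¹' {g} = X ⁻¹' {h} ∩ Y ⁻¹' {g - h} := by
    ext ω
    simp only [mem_inter_iff, mem_preimage, mem_singleton_iff]
    refine and_congr_right fun hω => ?_
    rw [hω, eq_sub_iff_add_eq, add_comm]
  rw [h1, measureReal_def, hXY.measure_inter_preimage_eq_mul _ _ (measurableSet_singleton _)
    (measurableSet_singleton _), ENNReal.toReal_mul]
  rfl

end RandomVariables

lemma exists_measure_of_mem_stdSimplex {G : Type v} [Fintype G] [MeasurableSpace G]
    [DiscreteMeasurableSpace G] {p : G → ℝ} (hp : p ∈ stdSimplex ℝ G) :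
    ∃ μ : Measure G, IsProbabilityMeasure μ ∧ ∀ g, μ.real {g} = p g := by
  have h : ∑ g, ENNReal.ofReal (p g) = 1 := by
    rw [← ENNReal.ofReal_sum_of_nonneg fun g _ => hp.1 g, hp.2, ENNReal.ofReal_one]
  refine ⟨(PMF.ofFintype _ h).toMeasure, inferInstance, fun g => ?_⟩
  rw [measureReal_def, PMF.toMeasure_apply_singleton _ _ (measurableSet_singleton g),
    PMF.ofFintype_apply, ENNReal.toReal_ofReal (hp.1 g)]

/-- Independent random variables enter `sumEntropies` only through their laws. -/
lemma mem_sumEntropies_iff {G : Type v} [AddCommGroup G] [Fintype G] [MeasurableSpace G]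
    [DiscreteMeasurableSpace G] {x y s : ℝ} :
    s ∈ sumEntropies.{max u v, v} G x y ↔ ∃ p ∈ stdSimplex ℝ G, ∃ q ∈ stdSimplex ℝ G,
      massEntropy p = x ∧ massEntropy q = y ∧ massEntropy (massConv p q) = s := by
  constructor
  · rintro ⟨Ω, _, μ, X, Y, _, hX, hY, hXY, rfl, rfl, rfl⟩
    refine ⟨_, law_mem_stdSimplex (μ := μ) hX, _, law_mem_stdSimplex (μ := μ) hY, rfl, rfl, ?_⟩
    simp only [massEntropy, shannonEntropy, law_add hX hXY]
  · rintro ⟨p, hp, q, hq, rfl, rfl, rfl⟩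
    obtain ⟨μ, hμ, hμp⟩ := exists_measure_of_mem_stdSimplex hp
    obtain ⟨ν, hν, hνq⟩ := exists_measure_of_mem_stdSimplex hq
    have hX : Measurable fun ω : G × ULift.{u} G => ω.1 := measurable_fst
    have hd : Measurable (ULift.down : ULift.{u} G → G) := measurable_down
    have hu : Measurable (ULift.up : G → ULift.{u} G) := measurable_up
    have hY : Measurable fun ω : G × ULift.{u} G => ω.2.down := hd.comp measurable_snd
    have hν' : IsProbabilityMeasure (ν.map (ULift.up : G → ULift.{u} G)) :=
      Measure.isProbabilityMeasure_map hu.aemeasurable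
    have hXY : IndepFun (fun ω : G × ULift.{u} G => ω.1) (fun ω => ω.2.down)
        (μ.prod (ν.map ULift.up)) := indepFun_prod measurable_id hd
    have h1 : ∀ g, (μ.prod (ν.map (ULift.up : G → ULift.{u} G))).real
        ((fun ω : G × ULift.{u} G => ω.1) ⁻¹' {g}) = p g := by
      intro g
      rw [← hμp g, measureReal_def, measureReal_def,
        ← Measure.map_apply hX (measurableSet_singleton g)]
      congr 1
      have := Measure.map_fst_prod (μ := μ) (ν := ν.map (ULift.up : G → ULift.{u} G))
      rw [measure_univ, one_smul] at this
      exact congrArg (fun m : Measure G => m {g}) this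
    have h2 : ∀ g, (μ.prod (ν.map (ULift.up : G → ULift.{u} G))).real
        ((fun ω : G × ULift.{u} G => ω.2.down) ⁻¹' {g}) = q g := by
      intro g
      have hm : MeasurableSet (ULift.down ⁻¹' {g} : Set (ULift.{u} G)) :=
        hd (measurableSet_singleton g)
      rw [← hνq g, measureReal_def, measureReal_def]
      congr 1
      change (μ.prod (ν.map ULift.up)) (Prod.snd ⁻¹' (ULift.down ⁻¹' {g})) = _
      rw [← Measure.map_apply measurable_snd hm, Measure.map_snd_prod, measure_univ, one_smul,
        Measure.map_apply hu hm]
      rfl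
    refine ⟨G × ULift.{u} G, inferInstance, μ.prod (ν.map ULift.up), _, _, inferInstance, hX, hY,
      hXY, ?_, ?_, ?_⟩
    · simp only [shannonEntropy, massEntropy, h1]
    · simp only [shannonEntropy, massEntropy, h2]
    · simp only [shannonEntropy, massEntropy, law_add hX hXY, h1, h2]

/-! ### Chain rule for a two-point split -/

lemma negMulLog_add_negMulLog_sub {a b : ℝ} (ha : 0 ≤ a) (hb : 0 ≤ b) :
    negMulLog a + negMulLog b =
      negMulLog (a + b) + (a + b) * biasEntropy ((a - b) / (a + b)) := by
  rcases (add_nonneg ha hb).eq_or_lt with h | h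
  · have h1 : a = 0 := by linarith
    have h2 : b = 0 := by linarith
    simp [h1, h2]
  · have key : ∀ S p : ℝ, negMulLog (S * (1 - p)) + negMulLog (S * p) =
        negMulLog S + S * binEntropy p := by
      intro S p
      rw [binEntropy_eq_negMulLog_add_negMulLog_one_sub, negMulLog_mul, negMulLog_mul]
      ring
    have e1 : (1 - (a - b) / (a + b)) / 2 = b / (a + b) := by
      field_simp
      ring
    rw [biasEntropy, e1, ← key]
    congr 2 <;> field_simp
    ring

lemma concaveOn_biasEntropy : ConcaveOn ℝ (Icc (-1) 1) biasEntropy := by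
  refine ⟨convex_Icc _ _, fun s hs t ht a b ha hb hab => ?_⟩
  have h := strictConcave_binEntropy.concaveOn.2 (x := (1 - s) / 2) (y := (1 - t) / 2)
    ⟨by linarith [hs.2], by linarith [hs.1]⟩ ⟨by linarith [ht.2], by linarith [ht.1]⟩ ha hb hab
  simp only [smul_eq_mul] at h ⊢
  rw [biasEntropy, biasEntropy, biasEntropy]
  convert h using 2
  linear_combination (-1 / 2 : ℝ) * hab

lemma div_mem_Icc_of_nonneg {a b : ℝ} (ha : 0 ≤ a) (hb : 0 ≤ b) :
    (a - b) / (a + b) ∈ Icc (-1 : ℝ) 1 := by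
  rcases (add_nonneg ha hb).eq_or_lt with h | h
  · rw [← h]
    norm_num
  · constructor
    · rw [le_div_iff₀ h]
      linarith
    · rw [div_le_one h]
      linarith

/-- The conditional entropy term `(a + b) h(a / (a + b))` is superadditive in `(a, b)`. -/
lemma mul_biasEntropy_superadditive {a b c d : ℝ} (ha : 0 ≤ a) (hb : 0 ≤ b) (hc : 0 ≤ c)
    (hd : 0 ≤ d) :
    (a + b) * biasEntropy ((a - b) / (a + b)) + (c + d) * biasEntropy ((c - d) / (c + d)) ≤
      (a + c + (b + d)) * biasEntropy ((a + c - (b + d)) / (a + c + (b + d))) := by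
  rcases (add_nonneg ha hb).eq_or_lt with h | h
  · obtain rfl : a = 0 := by linarith
    obtain rfl : b = 0 := by linarith
    simp
  rcases (add_nonneg hc hd).eq_or_lt with h' | h'
  · obtain rfl : c = 0 := by linarith
    obtain rfl : d = 0 := by linarith
    simp
  have hpos : 0 < a + c + (b + d) := by linarith
  have hw₀ : 0 ≤ (a + b) / (a + c + (b + d)) := by positivity
  have hw₁ : 0 ≤ (c + d) / (a + c + (b + d)) := by positivity
  have hw : (a + b) / (a + c + (b + d)) + (c + d) / (a + c + (b + d)) = 1 := by
    field_simp
    ring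
  have hj := concaveOn_biasEntropy.2 (div_mem_Icc_of_nonneg ha hb) (div_mem_Icc_of_nonneg hc hd)
    hw₀ hw₁ hw
  simp only [smul_eq_mul] at hj
  have e : (a + b) / (a + c + (b + d)) * ((a - b) / (a + b)) +
      (c + d) / (a + c + (b + d)) * ((c - d) / (c + d))
      = (a + c - (b + d)) / (a + c + (b + d)) := by
    field_simp
    ring
  rw [e] at hj
  have := mul_le_mul_of_nonneg_left hj hpos.le
  refine le_trans (le_of_eq ?_) this
  field_simp

/-! ### The group of order two -/

lemma sum_zmod_two (f : ZMod 2 → ℝ) : ∑ g, f g = f 0 + f 1 := Fin.sum_univ_two f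

lemma sum_zmod_four (f : ZMod 4 → ℝ) : ∑ g, f g = f 0 + f 1 + f 2 + f 3 := Fin.sum_univ_four f

lemma massConv_mem_stdSimplex {G : Type*} [AddCommGroup G] [Fintype G] {p q : G → ℝ}
    (hp : p ∈ stdSimplex ℝ G) (hq : q ∈ stdSimplex ℝ G) : massConv p q ∈ stdSimplex ℝ G := by
  refine ⟨fun g => Finset.sum_nonneg fun h _ => mul_nonneg (hp.1 h) (hq.1 _), ?_⟩
  simp only [massConv]
  rw [Finset.sum_comm]
  simp_rw [← Finset.mul_sum]
  have h : ∀ h : G, ∑ g, q (g - h) = 1 := fun h => by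
    rw [← hq.2]
    exact Equiv.sum_comp (Equiv.subRight h) q
  simp only [h, mul_one, hp.2]

lemma massEntropy_zmod_two {p : ZMod 2 → ℝ} (hp : p ∈ stdSimplex ℝ (ZMod 2)) :
    massEntropy p = biasEntropy (p 0 - p 1) := by
  have h := hp.2
  rw [sum_zmod_two] at h
  rw [massEntropy, sum_zmod_two, negMulLog_add_negMulLog_sub (hp.1 0) (hp.1 1), h]
  simp

lemma massConv_zmod_two (p q : ZMod 2 → ℝ) :
    massConv p q 0 - massConv p q 1 = (p 0 - p 1) * (q 0 - q 1) := by
  simp only [massConv, sum_zmod_two]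
  rw [show (0 - 0 : ZMod 2) = 0 by decide, show (0 - 1 : ZMod 2) = 1 by decide,
    show (1 - 0 : ZMod 2) = 1 by decide, show (1 - 1 : ZMod 2) = 0 by decide]
  ring

/-- The law on `ZMod 2` of bias `s`. -/
noncomputable def bitLaw (s : ℝ) : ZMod 2 → ℝ := ![(1 + s) / 2, (1 - s) / 2]

lemma bitLaw_mem {s : ℝ} (hs : s ∈ Icc (0 : ℝ) 1) : bitLaw s ∈ stdSimplex ℝ (ZMod 2) := by
  constructor
  · intro g
    fin_cases g
    · show 0 ≤ (1 + s) / 2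
      linarith [hs.1]
    · show 0 ≤ (1 - s) / 2
      linarith [hs.2]
  · rw [sum_zmod_two]
    show (1 + s) / 2 + (1 - s) / 2 = 1
    ring

lemma bitLaw_sub (s : ℝ) : bitLaw s 0 - bitLaw s 1 = s := by
  show (1 + s) / 2 - (1 - s) / 2 = s
  ring

lemma abs_sub_mem_Icc {a b : ℝ} (ha : 0 ≤ a) (hb : 0 ≤ b) (hab : a + b = 1) :
    |a - b| ∈ Icc (0 : ℝ) 1 :=
  ⟨abs_nonneg _, abs_le.2 ⟨by linarith, by linarith⟩⟩

lemma biasEntropy_abs_mul_abs (s t : ℝ) : biasEntropy (|s| * |t|) = biasEntropy (s * t) := by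
  rw [← abs_mul, biasEntropy_abs]

/-- On `ZMod 2` the entropies of two independent summands determine that of the sum. -/
lemma sumEntropies_zmod_two {s t : ℝ} (hs : s ∈ Icc (0 : ℝ) 1) (ht : t ∈ Icc (0 : ℝ) 1) :
    sumEntropies.{u} (ZMod 2) (biasEntropy s) (biasEntropy t) = {biasEntropy (s * t)} := by
  ext z
  rw [mem_sumEntropies_iff.{u}, mem_singleton_iff]
  constructor
  · rintro ⟨p, hp, q, hq, hps, hqt, rfl⟩
    have hp1 := hp.2
    have hq1 := hq.2
    rw [sum_zmod_two] at hp1 hq1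
    rw [massEntropy_zmod_two hp, ← biasEntropy_abs] at hps
    rw [massEntropy_zmod_two hq, ← biasEntropy_abs] at hqt
    rw [massEntropy_zmod_two (massConv_mem_stdSimplex hp hq), massConv_zmod_two,
      ← biasEntropy_abs_mul_abs,
      strictAntiOn_biasEntropy.injOn (abs_sub_mem_Icc (hp.1 0) (hp.1 1) hp1) hs hps,
      strictAntiOn_biasEntropy.injOn (abs_sub_mem_Icc (hq.1 0) (hq.1 1) hq1) ht hqt]
  · rintro rfl
    refine ⟨bitLaw s, bitLaw_mem hs, bitLaw t, bitLaw_mem ht, ?_, ?_, ?_⟩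
    · rw [massEntropy_zmod_two (bitLaw_mem hs), bitLaw_sub]
    · rw [massEntropy_zmod_two (bitLaw_mem ht), bitLaw_sub]
    · rw [massEntropy_zmod_two (massConv_mem_stdSimplex (bitLaw_mem hs) (bitLaw_mem ht)),
        massConv_zmod_two, bitLaw_sub, bitLaw_sub]

/-! ### Lower bound on the group of order four -/

/-- Chain rule for the entropy on `ZMod 4`: the entropy of the parity plus the conditional entropy
given the parity. A coset of probability `0` has the junk bias `0 / 0 = 0`, with weight `0`. -/
lemma massEntropy_zmod_four {p : ZMod 4 → ℝ} (hp : p ∈ stdSimplex ℝ (ZMod 4)) :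
    massEntropy p = biasEntropy (p 0 + p 2 - (p 1 + p 3)) +
      ((p 0 + p 2) * biasEntropy ((p 0 - p 2) / (p 0 + p 2)) +
        (p 1 + p 3) * biasEntropy ((p 1 - p 3) / (p 1 + p 3))) := by
  have h := hp.2
  rw [sum_zmod_four] at h
  have h1 := negMulLog_add_negMulLog_sub (hp.1 0) (hp.1 2)
  have h2 := negMulLog_add_negMulLog_sub (hp.1 1) (hp.1 3)
  have h3 := negMulLog_add_negMulLog_sub (add_nonneg (hp.1 0) (hp.1 2))
    (add_nonneg (hp.1 1) (hp.1 3))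
  rw [show p 0 + p 2 + (p 1 + p 3) = 1 by linarith, negMulLog_one, div_one, one_mul,
    zero_add] at h3
  rw [massEntropy, sum_zmod_four]
  linarith

lemma massConv_zmod_four_zero (p q : ZMod 4 → ℝ) :
    massConv p q 0 = p 0 * q 0 + p 1 * q 3 + p 2 * q 2 + p 3 * q 1 := by
  simp only [massConv, sum_zmod_four]
  rw [show (0 - 0 : ZMod 4) = 0 by decide, show (0 - 1 : ZMod 4) = 3 by decide,
    show (0 - 2 : ZMod 4) = 2 by decide, show (0 - 3 : ZMod 4) = 1 by decide]

lemma massConv_zmod_four_one (p q : ZMod 4 → ℝ) :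
    massConv p q 1 = p 0 * q 1 + p 1 * q 0 + p 2 * q 3 + p 3 * q 2 := by
  simp only [massConv, sum_zmod_four]
  rw [show (1 - 0 : ZMod 4) = 1 by decide, show (1 - 1 : ZMod 4) = 0 by decide,
    show (1 - 2 : ZMod 4) = 3 by decide, show (1 - 3 : ZMod 4) = 2 by decide]

lemma massConv_zmod_four_two (p q : ZMod 4 → ℝ) :
    massConv p q 2 = p 0 * q 2 + p 1 * q 1 + p 2 * q 0 + p 3 * q 3 := by
  simp only [massConv, sum_zmod_four]
  rw [show (2 - 0 : ZMod 4) = 2 by decide, show (2 - 1 : ZMod 4) = 1 by decide,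
    show (2 - 2 : ZMod 4) = 0 by decide, show (2 - 3 : ZMod 4) = 3 by decide]

lemma massConv_zmod_four_three (p q : ZMod 4 → ℝ) :
    massConv p q 3 = p 0 * q 3 + p 1 * q 2 + p 2 * q 1 + p 3 * q 0 := by
  simp only [massConv, sum_zmod_four]
  rw [show (3 - 0 : ZMod 4) = 3 by decide, show (3 - 1 : ZMod 4) = 2 by decide,
    show (3 - 2 : ZMod 4) = 1 by decide, show (3 - 3 : ZMod 4) = 0 by decide]

lemma abs_mem_Icc {s : ℝ} (hs : s ∈ Icc (-1 : ℝ) 1) : |s| ∈ Icc (0 : ℝ) 1 :=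
  ⟨abs_nonneg s, abs_le.2 hs⟩

/-- Mrs. Gerber's lemma applied to both arguments of `f₂`, with signed biases. -/
lemma gerber_jensen_two {a₀ a₁ b₀ b₁ s s₀ s₁ t t₀ t₁ : ℝ} (ha₀ : 0 ≤ a₀) (ha₁ : 0 ≤ a₁)
    (ha : a₀ + a₁ = 1) (hb₀ : 0 ≤ b₀) (hb₁ : 0 ≤ b₁) (hb : b₀ + b₁ = 1)
    (hs : s ∈ Icc (0 : ℝ) 1) (hs₀ : s₀ ∈ Icc (-1 : ℝ) 1) (hs₁ : s₁ ∈ Icc (-1 : ℝ) 1)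
    (ht : t ∈ Icc (0 : ℝ) 1) (ht₀ : t₀ ∈ Icc (-1 : ℝ) 1) (ht₁ : t₁ ∈ Icc (-1 : ℝ) 1)
    (h : a₀ * biasEntropy s₀ + a₁ * biasEntropy s₁ = biasEntropy s)
    (h' : b₀ * biasEntropy t₀ + b₁ * biasEntropy t₁ = biasEntropy t) :
    biasEntropy (s * t) ≤
      a₀ * b₀ * biasEntropy (s₀ * t₀) + a₁ * b₁ * biasEntropy (s₁ * t₁) +
      (a₀ * b₁ * biasEntropy (s₀ * t₁) + a₁ * b₀ * biasEntropy (s₁ * t₀)) := by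
  rw [← biasEntropy_abs s₀, ← biasEntropy_abs s₁] at h
  rw [← biasEntropy_abs t₀, ← biasEntropy_abs t₁] at h'
  have hj := gerber_jensen ha₀ ha₁ ha hs (abs_mem_Icc hs₀) (abs_mem_Icc hs₁) ht h
  have hj' : ∀ r ∈ Icc (-1 : ℝ) 1,
      biasEntropy (|r| * t) ≤ b₀ * biasEntropy (r * t₀) + b₁ * biasEntropy (r * t₁) := by
    intro r hr
    have := gerber_jensen hb₀ hb₁ hb ht (abs_mem_Icc ht₀) (abs_mem_Icc ht₁) (abs_mem_Icc hr) h'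
    rwa [biasEntropy_abs_mul_abs, biasEntropy_abs_mul_abs, mul_comm t, mul_comm t₀,
      mul_comm t₁] at this
  have h0 := mul_le_mul_of_nonneg_left (hj' s₀ hs₀) ha₀
  have h1 := mul_le_mul_of_nonneg_left (hj' s₁ hs₁) ha₁
  linarith

lemma mixture_mem_Icc {a₀ a₁ s₀ s₁ : ℝ} (ha₀ : 0 ≤ a₀) (ha₁ : 0 ≤ a₁) (ha : a₀ + a₁ = 1)
    (hs₀ : s₀ ∈ Icc (-1 : ℝ) 1) (hs₁ : s₁ ∈ Icc (-1 : ℝ) 1) :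
    a₀ * biasEntropy s₀ + a₁ * biasEntropy s₁ ∈ Icc 0 (log 2) := by
  refine ⟨add_nonneg (mul_nonneg ha₀ (biasEntropy_nonneg hs₀))
    (mul_nonneg ha₁ (biasEntropy_nonneg hs₁)), ?_⟩
  have h0 := mul_le_mul_of_nonneg_left (biasEntropy_le s₀) ha₀
  have h1 := mul_le_mul_of_nonneg_left (biasEntropy_le s₁) ha₁
  have h2 : a₀ * log 2 + a₁ * log 2 = log 2 := by rw [← add_mul, ha, one_mul]
  linarith

/-- Conditioning on the parities of both summands splits the problem on `ZMod 4` into two problems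
on `ZMod 2`: one for the parities, and one for the conditional entropies given the parities. -/
lemma exists_le_massEntropy_massConv {p q : ZMod 4 → ℝ} (hp : p ∈ stdSimplex ℝ (ZMod 4))
    (hq : q ∈ stdSimplex ℝ (ZMod 4)) :
    ∃ s₁ ∈ Icc (0 : ℝ) 1, ∃ s₂ ∈ Icc (0 : ℝ) 1, ∃ t₁ ∈ Icc (0 : ℝ) 1, ∃ t₂ ∈ Icc (0 : ℝ) 1,
      massEntropy p = biasEntropy s₁ + biasEntropy s₂ ∧
      massEntropy q = biasEntropy t₁ + biasEntropy t₂ ∧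
      biasEntropy (s₁ * t₁) + biasEntropy (s₂ * t₂) ≤ massEntropy (massConv p q) := by
  have ha₀ := add_nonneg (hp.1 0) (hp.1 2)
  have ha₁ := add_nonneg (hp.1 1) (hp.1 3)
  have hb₀ := add_nonneg (hq.1 0) (hq.1 2)
  have hb₁ := add_nonneg (hq.1 1) (hq.1 3)
  have ha : p 0 + p 2 + (p 1 + p 3) = 1 := by
    rw [← hp.2, sum_zmod_four]
    ring
  have hb : q 0 + q 2 + (q 1 + q 3) = 1 := by
    rw [← hq.2, sum_zmod_four]
    ring
  have hs₀ := div_mem_Icc_of_nonneg (hp.1 0) (hp.1 2)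
  have hs₁ := div_mem_Icc_of_nonneg (hp.1 1) (hp.1 3)
  have ht₀ := div_mem_Icc_of_nonneg (hq.1 0) (hq.1 2)
  have ht₁ := div_mem_Icc_of_nonneg (hq.1 1) (hq.1 3)
  obtain ⟨s, hs, hse⟩ := exists_biasEntropy_eq (mixture_mem_Icc ha₀ ha₁ ha hs₀ hs₁)
  obtain ⟨t, ht, hte⟩ := exists_biasEntropy_eq (mixture_mem_Icc hb₀ hb₁ hb ht₀ ht₁)
  refine ⟨_, abs_sub_mem_Icc ha₀ ha₁ ha, s, hs, _, abs_sub_mem_Icc hb₀ hb₁ hb, t, ht, ?_, ?_, ?_⟩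
  · rw [massEntropy_zmod_four hp, hse, biasEntropy_abs]
  · rw [massEntropy_zmod_four hq, hte, biasEntropy_abs]
  have hj := gerber_jensen_two ha₀ ha₁ ha hb₀ hb₁ hb hs hs₀ hs₁ ht ht₀ ht₁ hse.symm hte.symm
  rw [massEntropy_zmod_four (massConv_mem_stdSimplex hp hq), biasEntropy_abs_mul_abs,
    massConv_zmod_four_zero, massConv_zmod_four_one, massConv_zmod_four_two,
    massConv_zmod_four_three]
  have m : ∀ i j k l, 0 ≤ p i * q j + p k * q l := fun i j k l =>
    add_nonneg (mul_nonneg (hp.1 i) (hq.1 j)) (mul_nonneg (hp.1 k) (hq.1 l))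
  have heven := mul_biasEntropy_superadditive (m 0 0 2 2) (m 0 2 2 0) (m 1 3 3 1) (m 1 1 3 3)
  have hodd := mul_biasEntropy_superadditive (m 0 1 2 3) (m 0 3 2 1) (m 1 0 3 2) (m 1 2 3 0)
  rw [show p 0 * q 0 + p 2 * q 2 + (p 0 * q 2 + p 2 * q 0) = (p 0 + p 2) * (q 0 + q 2) by ring,
    show p 0 * q 0 + p 2 * q 2 - (p 0 * q 2 + p 2 * q 0) = (p 0 - p 2) * (q 0 - q 2) by ring,
    show p 1 * q 3 + p 3 * q 1 + (p 1 * q 1 + p 3 * q 3) = (p 1 + p 3) * (q 1 + q 3) by ring,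
    show p 1 * q 3 + p 3 * q 1 - (p 1 * q 1 + p 3 * q 3) = -((p 1 - p 3) * (q 1 - q 3)) by ring,
    neg_div, biasEntropy_neg, ← div_mul_div_comm, ← div_mul_div_comm] at heven
  rw [show p 0 * q 1 + p 2 * q 3 + (p 0 * q 3 + p 2 * q 1) = (p 0 + p 2) * (q 1 + q 3) by ring,
    show p 0 * q 1 + p 2 * q 3 - (p 0 * q 3 + p 2 * q 1) = (p 0 - p 2) * (q 1 - q 3) by ring,
    show p 1 * q 0 + p 3 * q 2 + (p 1 * q 2 + p 3 * q 0) = (p 1 + p 3) * (q 0 + q 2) by ring,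
    show p 1 * q 0 + p 3 * q 2 - (p 1 * q 2 + p 3 * q 0) = (p 1 - p 3) * (q 0 - q 2) by ring,
    ← div_mul_div_comm, ← div_mul_div_comm] at hodd
  have h := add_le_add_right (hj.trans (add_le_add heven hodd))
    (biasEntropy ((p 0 + p 2 - (p 1 + p 3)) * (q 0 + q 2 - (q 1 + q 3))))
  refine h.trans (le_of_eq ?_)
  congr 2
  · ring
  · congr 1
    · ring
    · congr 2 <;> ring
  · congr 1
    · ring
    · congr 2 <;> ring

/-! ### Extremal laws -/

/-- The law on `ZMod 4` whose parity has bias `s`, and whose conditional law on each coset of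
`{0, 2}` has bias `t`. -/
noncomputable def cosetLaw (s t : ℝ) : ZMod 4 → ℝ :=
  ![(1 + s) * (1 + t) / 4, (1 - s) * (1 + t) / 4, (1 + s) * (1 - t) / 4, (1 - s) * (1 - t) / 4]

lemma cosetLaw_zero (s t : ℝ) : cosetLaw s t 0 = (1 + s) * (1 + t) / 4 := rfl

lemma cosetLaw_one (s t : ℝ) : cosetLaw s t 1 = (1 - s) * (1 + t) / 4 := rfl

lemma cosetLaw_two (s t : ℝ) : cosetLaw s t 2 = (1 + s) * (1 - t) / 4 := rfl

lemma cosetLaw_three (s t : ℝ) : cosetLaw s t 3 = (1 - s) * (1 - t) / 4 := rfl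

lemma cosetLaw_mem {s t : ℝ} (hs : s ∈ Icc (0 : ℝ) 1) (ht : t ∈ Icc (0 : ℝ) 1) :
    cosetLaw s t ∈ stdSimplex ℝ (ZMod 4) := by
  have h1 : 0 ≤ 1 + s := by linarith [hs.1]
  have h2 : 0 ≤ 1 - s := by linarith [hs.2]
  have h3 : 0 ≤ 1 + t := by linarith [ht.1]
  have h4 : 0 ≤ 1 - t := by linarith [ht.2]
  constructor
  · intro g
    fin_cases g
    · show 0 ≤ (1 + s) * (1 + t) / 4
      positivity
    · show 0 ≤ (1 - s) * (1 + t) / 4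
      positivity
    · show 0 ≤ (1 + s) * (1 - t) / 4
      positivity
    · show 0 ≤ (1 - s) * (1 - t) / 4
      positivity
  · rw [sum_zmod_four, cosetLaw_zero, cosetLaw_one, cosetLaw_two, cosetLaw_three]
    ring

lemma massEntropy_cosetLaw {s t : ℝ} (hs : s ∈ Icc (0 : ℝ) 1) (ht : t ∈ Icc (0 : ℝ) 1) :
    massEntropy (cosetLaw s t) = biasEntropy s + biasEntropy t := by
  rw [massEntropy_zmod_four (cosetLaw_mem hs ht), cosetLaw_zero, cosetLaw_one, cosetLaw_two,
    cosetLaw_three]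
  have key : ∀ a : ℝ, (a * (1 + t) / 4 + a * (1 - t) / 4) *
      biasEntropy ((a * (1 + t) / 4 - a * (1 - t) / 4) / (a * (1 + t) / 4 + a * (1 - t) / 4))
        = a / 2 * biasEntropy t := by
    intro a
    rcases eq_or_ne a 0 with rfl | ha
    · simp
    · rw [show a * (1 + t) / 4 + a * (1 - t) / 4 = a / 2 by ring,
        show a * (1 + t) / 4 - a * (1 - t) / 4 = a / 2 * t by ring,
        mul_div_cancel_left₀ t (div_ne_zero ha two_ne_zero)]
  rw [key, key]
  have : (1 + s) * (1 + t) / 4 + (1 + s) * (1 - t) / 4 -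
    ((1 - s) * (1 + t) / 4 + (1 - s) * (1 - t) / 4) = s := by ring
  rw [this]
  ring

lemma zmod_four_ext {p q : ZMod 4 → ℝ} (h0 : p 0 = q 0) (h1 : p 1 = q 1) (h2 : p 2 = q 2)
    (h3 : p 3 = q 3) : p = q := by
  funext g
  fin_cases g <;> assumption

lemma massConv_cosetLaw_one_right (s t r : ℝ) :
    massConv (cosetLaw s t) (cosetLaw 1 r) = cosetLaw s (t * r) := by
  apply zmod_four_ext <;>
  simp only [massConv_zmod_four_zero, massConv_zmod_four_one, massConv_zmod_four_two,
    massConv_zmod_four_three, cosetLaw_zero, cosetLaw_one, cosetLaw_two, cosetLaw_three] <;> ring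

lemma massConv_cosetLaw_one_left (s t r : ℝ) :
    massConv (cosetLaw 1 r) (cosetLaw s t) = cosetLaw s (r * t) := by
  apply zmod_four_ext <;>
  simp only [massConv_zmod_four_zero, massConv_zmod_four_one, massConv_zmod_four_two,
    massConv_zmod_four_three, cosetLaw_zero, cosetLaw_one, cosetLaw_two, cosetLaw_three] <;> ring

lemma massConv_cosetLaw_zero (s t : ℝ) :
    massConv (cosetLaw s 0) (cosetLaw t 0) = cosetLaw (s * t) 0 := by
  apply zmod_four_ext <;>
  simp only [massConv_zmod_four_zero, massConv_zmod_four_one, massConv_zmod_four_two,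
    massConv_zmod_four_three, cosetLaw_zero, cosetLaw_one, cosetLaw_two, cosetLaw_three] <;> ring

lemma mem_sumEntropies_zmod_four {s t s' t' s'' t'' : ℝ} (hs : s ∈ Icc (0 : ℝ) 1)
    (ht : t ∈ Icc (0 : ℝ) 1) (hs' : s' ∈ Icc (0 : ℝ) 1) (ht' : t' ∈ Icc (0 : ℝ) 1)
    (hs'' : s'' ∈ Icc (0 : ℝ) 1) (ht'' : t'' ∈ Icc (0 : ℝ) 1)
    (h : massConv (cosetLaw s t) (cosetLaw s' t') = cosetLaw s'' t'') :
    biasEntropy s'' + biasEntropy t'' ∈ sumEntropies.{u} (ZMod 4)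
      (biasEntropy s + biasEntropy t) (biasEntropy s' + biasEntropy t') :=
  mem_sumEntropies_iff.{u}.2 ⟨_, cosetLaw_mem hs ht, _, cosetLaw_mem hs' ht',
    massEntropy_cosetLaw hs ht, massEntropy_cosetLaw hs' ht',
    by rw [h, massEntropy_cosetLaw hs'' ht'']⟩

/-! ### Evaluation of the minima -/

lemma le_of_mem_sumEntropies_zmod_four {x y z c : ℝ} (hz : z ∈ sumEntropies.{u} (ZMod 4) x y)
    (h : ∀ s₁ ∈ Icc (0 : ℝ) 1, ∀ s₂ ∈ Icc (0 : ℝ) 1, ∀ t₁ ∈ Icc (0 : ℝ) 1, ∀ t₂ ∈ Icc (0 : ℝ) 1,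
      biasEntropy s₁ + biasEntropy s₂ = x → biasEntropy t₁ + biasEntropy t₂ = y →
      c ≤ biasEntropy (s₁ * t₁) + biasEntropy (s₂ * t₂)) : c ≤ z := by
  obtain ⟨p, hp, q, hq, hx, hy, rfl⟩ := mem_sumEntropies_iff.{u}.1 hz
  obtain ⟨s₁, hs₁, s₂, hs₂, t₁, ht₁, t₂, ht₂, hpe, hqe, hle⟩ :=
    exists_le_massEntropy_massConv hp hq
  exact (h s₁ hs₁ s₂ hs₂ t₁ ht₁ t₂ ht₂ (hpe.symm.trans hx) (hqe.symm.trans hy)).trans hle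

lemma exists_log_two_add_biasEntropy_eq {x : ℝ} (hx : x ∈ Icc (log 2) (log 4)) :
    ∃ s ∈ Icc (0 : ℝ) 1, biasEntropy s + biasEntropy 0 = x := by
  have h4 : log 4 = log 2 + log 2 := by
    rw [← log_mul two_ne_zero two_ne_zero]
    norm_num
  obtain ⟨s, hs, h⟩ := exists_biasEntropy_eq (x := x - log 2)
    ⟨by linarith [hx.1], by linarith [hx.2]⟩
  exact ⟨s, hs, by rw [h, biasEntropy_zero]; ring⟩

lemma isLeast_zmod_two {s t : ℝ} (hs : s ∈ Icc (0 : ℝ) 1) (ht : t ∈ Icc (0 : ℝ) 1) :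
    IsLeast (sumEntropies.{u} (ZMod 2) (biasEntropy s) (biasEntropy t)) (biasEntropy (s * t)) := by
  rw [sumEntropies_zmod_two hs ht]
  exact isLeast_singleton

lemma minSumEntropy_zmod_two {s t : ℝ} (hs : s ∈ Icc (0 : ℝ) 1) (ht : t ∈ Icc (0 : ℝ) 1) :
    minSumEntropy.{u} (ZMod 2) (biasEntropy s) (biasEntropy t) = biasEntropy (s * t) :=
  (isLeast_zmod_two hs ht).csInf_eq

/-- The minimum is attained by a sum of a variable that is uniform on each coset of `{0, 2}` and a
variable with values in `{0, 2}`. -/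
lemma isLeast_zmod_four_left {x y : ℝ} (hx : x ∈ Icc (log 2) (log 4)) (hy : y ∈ Icc 0 (log 2)) :
    IsLeast (sumEntropies.{u} (ZMod 4) x y) x := by
  constructor
  · obtain ⟨s, hs, rfl⟩ := exists_log_two_add_biasEntropy_eq hx
    obtain ⟨t, ht, rfl⟩ := exists_biasEntropy_eq hy
    have h0 := left_mem_Icc.2 (zero_le_one' ℝ)
    have h1 := right_mem_Icc.2 (zero_le_one' ℝ)
    have h := mem_sumEntropies_zmod_four.{u} hs h0 h1 ht hs h0
      (by rw [massConv_cosetLaw_one_right, zero_mul])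
    rwa [biasEntropy_one, zero_add] at h
  · intro z hz
    refine le_of_mem_sumEntropies_zmod_four hz fun s₁ hs₁ s₂ hs₂ t₁ ht₁ t₂ ht₂ hxe _ => ?_
    rw [← hxe]
    exact add_le_add (biasEntropy_le_biasEntropy_mul hs₁ ht₁)
      (biasEntropy_le_biasEntropy_mul hs₂ ht₂)

lemma isLeast_zmod_four_right {x y : ℝ} (hx : x ∈ Icc 0 (log 2)) (hy : y ∈ Icc (log 2) (log 4)) :
    IsLeast (sumEntropies.{u} (ZMod 4) x y) y := by
  constructor
  · obtain ⟨s, hs, rfl⟩ := exists_biasEntropy_eq hx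
    obtain ⟨t, ht, rfl⟩ := exists_log_two_add_biasEntropy_eq hy
    have h0 := left_mem_Icc.2 (zero_le_one' ℝ)
    have h1 := right_mem_Icc.2 (zero_le_one' ℝ)
    have h := mem_sumEntropies_zmod_four.{u} h1 hs ht h0 ht h0
      (by rw [massConv_cosetLaw_one_left, mul_zero])
    rwa [biasEntropy_one, zero_add] at h
  · intro z hz
    refine le_of_mem_sumEntropies_zmod_four hz fun s₁ hs₁ s₂ hs₂ t₁ ht₁ t₂ ht₂ _ hye => ?_
    rw [← hye]
    exact add_le_add (biasEntropy_le_biasEntropy_mul' hs₁ ht₁)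
      (biasEntropy_le_biasEntropy_mul' hs₂ ht₂)

/-- The minimum is attained by variables with values in the subgroup `{0, 2}`. -/
lemma isLeast_zmod_four_low {x y : ℝ} (hx : x ∈ Icc 0 (log 2)) (hy : y ∈ Icc 0 (log 2)) :
    IsLeast (sumEntropies.{u} (ZMod 4) x y) (minSumEntropy.{u} (ZMod 2) x y) := by
  obtain ⟨s, hs, rfl⟩ := exists_biasEntropy_eq hx
  obtain ⟨t, ht, rfl⟩ := exists_biasEntropy_eq hy
  rw [minSumEntropy_zmod_two hs ht]
  constructor
  · have h1 := right_mem_Icc.2 (zero_le_one' ℝ)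
    have h := mem_sumEntropies_zmod_four.{u} h1 hs h1 ht h1
      ⟨mul_nonneg hs.1 ht.1, mul_le_one₀ hs.2 ht.1 ht.2⟩ (massConv_cosetLaw_one_right 1 s t)
    simpa only [biasEntropy_one, zero_add] using h
  · intro z hz
    exact le_of_mem_sumEntropies_zmod_four hz fun s₁ hs₁ s₂ hs₂ t₁ ht₁ t₂ ht₂ hxe hye =>
      biasEntropy_mul_subadditive hs hs₁ hs₂ ht ht₁ ht₂ hxe hye

/-- The minimum is attained by variables that are uniform on each coset of `{0, 2}`. -/
lemma isLeast_zmod_four_high {x y : ℝ} (hx : x ∈ Icc (log 2) (log 4))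
    (hy : y ∈ Icc (log 2) (log 4)) :
    IsLeast (sumEntropies.{u} (ZMod 4) x y)
      (minSumEntropy.{u} (ZMod 2) (x - log 2) (y - log 2) + log 2) := by
  obtain ⟨s, hs, rfl⟩ := exists_log_two_add_biasEntropy_eq hx
  obtain ⟨t, ht, rfl⟩ := exists_log_two_add_biasEntropy_eq hy
  have hL := biasEntropy_zero
  rw [← hL, add_sub_cancel_right, add_sub_cancel_right, minSumEntropy_zmod_two hs ht]
  constructor
  · have h0 := left_mem_Icc.2 (zero_le_one' ℝ)
    exact mem_sumEntropies_zmod_four.{u} hs h0 ht h0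
      ⟨mul_nonneg hs.1 ht.1, mul_le_one₀ hs.2 ht.1 ht.2⟩ h0 (massConv_cosetLaw_zero s t)
  · intro z hz
    refine le_of_mem_sumEntropies_zmod_four hz fun s₁ hs₁ s₂ hs₂ t₁ ht₁ t₂ ht₂ hxe hye => ?_
    rw [hL] at hxe hye ⊢
    rw [add_comm]
    exact deficit_mul_superadditive hs hs₁ hs₂ ht ht₁ ht₂ (by linarith) (by linarith)

theorem theorem3p1 :
    -- the minima defining `f_4` and `f_2` exist on `[0, log 4]²` and `[0, log 2]²`
    (∀ x ∈ Set.Icc 0 (Real.log 4), ∀ y ∈ Set.Icc 0 (Real.log 4),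
      IsLeast (sumEntropies.{u} (ZMod 4) x y) (minSumEntropy.{u} (ZMod 4) x y)) ∧
    (∀ x ∈ Set.Icc 0 (Real.log 2), ∀ y ∈ Set.Icc 0 (Real.log 2),
      IsLeast (sumEntropies.{u} (ZMod 2) x y) (minSumEntropy.{u} (ZMod 2) x y)) ∧
    -- the formula for `f_4`
    (∀ x ∈ Set.Icc (Real.log 2) (Real.log 4), ∀ y ∈ Set.Icc 0 (Real.log 2),
      minSumEntropy.{u} (ZMod 4) x y = x) ∧
    (∀ x ∈ Set.Icc 0 (Real.log 2), ∀ y ∈ Set.Icc (Real.log 2) (Real.log 4),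
      minSumEntropy.{u} (ZMod 4) x y = y) ∧
    (∀ x ∈ Set.Icc 0 (Real.log 2), ∀ y ∈ Set.Icc 0 (Real.log 2),
      minSumEntropy.{u} (ZMod 4) x y = minSumEntropy.{u} (ZMod 2) x y) ∧
    (∀ x ∈ Set.Icc (Real.log 2) (Real.log 4), ∀ y ∈ Set.Icc (Real.log 2) (Real.log 4),
      minSumEntropy.{u} (ZMod 4) x y =
        minSumEntropy.{u} (ZMod 2) (x - Real.log 2) (y - Real.log 2) + Real.log 2) := by
  have hmin : ∀ {x y c : ℝ}, IsLeast (sumEntropies.{u} (ZMod 4) x y) c →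
      IsLeast (sumEntropies.{u} (ZMod 4) x y) (minSumEntropy.{u} (ZMod 4) x y) := by
    intro x y c h
    rwa [minSumEntropy, h.csInf_eq]
  refine ⟨fun x hx y hy => ?_, fun x hx y hy => ?_,
    fun x hx y hy => (isLeast_zmod_four_left hx hy).csInf_eq,
    fun x hx y hy => (isLeast_zmod_four_right hx hy).csInf_eq,
    fun x hx y hy => (isLeast_zmod_four_low hx hy).csInf_eq,
    fun x hx y hy => (isLeast_zmod_four_high hx hy).csInf_eq⟩
  · rcases le_total x (log 2) with h1 | h1 <;> rcases le_total y (log 2) with h2 | h2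
    · exact hmin (isLeast_zmod_four_low ⟨hx.1, h1⟩ ⟨hy.1, h2⟩)
    · exact hmin (isLeast_zmod_four_right ⟨hx.1, h1⟩ ⟨h2, hy.2⟩)
    · exact hmin (isLeast_zmod_four_left ⟨h1, hx.2⟩ ⟨hy.1, h2⟩)
    · exact hmin (isLeast_zmod_four_high ⟨h1, hx.2⟩ ⟨h2, hy.2⟩)
  · obtain ⟨s, hs, rfl⟩ := exists_biasEntropy_eq hx
    obtain ⟨t, ht, rfl⟩ := exists_biasEntropy_eq hy
    rw [minSumEntropy_zmod_two hs ht]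
    exact isLeast_zmod_two hs ht
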